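/- Let $n\ge 0$ be an integer and $p>0$ a real number. For $z\in\mathbb C^n$ put $|z|=(|z_1|^2+\cdots+|z_n|^2)^{1/2}$; for a multi-index $\alpha\in\mathbb Z_{\ge0}^n$ put $|\alpha|=\alpha_1+\cdots+\alpha_n$, $\alpha!=\alpha_1!\cdots\alpha_n!$ and $\partial_z^\alpha=(\partial/\partial z_1)^{\alpha_1}\cdots(\partial/\partial z_n)^{\alpha_n}$. For $\tau>0$ let $A_{p,\tau}$ be the Banach space of entire functions $f$ on $\mathbb C^n$ with $$\|f\|_{p,\tau}:=\sup_{z\in\mathbb C^n}|f(z)|\exp(-\tau|z|^p)<\infty,$$ and let $A_{p,0}=\varprojlim_{\tau>0}A_{p,\tau}=\bigcap_{\tau>0}A_{p,\tau}$, with the projective limit topology, be the space of entire functions of order at most $p$ of minimal type. Let $1/q:=1-1/p$ (so $1/q=0$ if $p=1$), and read $|\alpha|^{|\alpha|/p}$ as $1$ for $\alpha=0$. For a formal differential operator $P=\sum_{\alpha\in\mathbb Z_{\ge0}^n}a_\alpha(z)\partial_z^\alpha$ of infinite order with entire coefficients $a_\alpha$, consider the following conditions, each required to hold for every $\varepsilon>0$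 with some $B=B(\varepsilon)>0$: (I)$_0$ $\displaystyle |a_\alpha(z)|\le\frac{B^{|\alpha|+1}}{(|\alpha|!)^{1/q}}\exp(\varepsilon|z|^p)$ for all $z\in\mathbb C^n$ and all $\alpha$; (II)$_0$ $\displaystyle |a_\alpha(z)|\le\frac{|\alpha|^{|\alpha|/p}}{\alpha!}B^{|\alpha|+1}\exp(\varepsilon|z|^p)$ for all $z\in\mathbb C^n$ and all $\alpha$; (III)$_0$ $\displaystyle \|a_\alpha\|_{p,\varepsilon}\le\frac{B^{|\alpha|+1}}{(|\alpha|!)^{1/q}}$ for all $\alpha$; (IV)$_0$ $\displaystyle \|a_\alpha\|_{p,\varepsilon}\le\frac{|\alpha|^{|\alpha|/p}}{\alpha!}B^{|\alpha|+1}$ for all $\alpha$. These four conditions are equivalent. Let $\boldsymbol D_{p,0}$ be the set of all $P$ that satisfy one of them. Then: (i) Let $P=\sum_\alpha a_\alpha\partial_z^\alpha\in\boldsymbol D_{p,0}$. For every $f\in A_{p,0}$ all terms $a_\alpha\partial_z^\alpha f$ belong to $A_{p,0}$, the series $Pf:=\sum_\alpha a_\alpha\,\partial_z^\alpha f$ converges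 absolutely at every point of $\mathbb C^n$ and unconditionally in $A_{p,0}$, and $Pf\in A_{p,0}$. Moreover, $f\mapsto Pf$ is a continuous linear operator $A_{p,0}\to A_{p,0}$. (ii) For every continuous linear operator $F:A_{p,0}\to A_{p,0}$ there is a unique $P\in\boldsymbol D_{p,0}$ such that $Ff=Pf$ for all $f\in A_{p,0}$. -/

import Mathlib

open scoped ENNReal

noncomputable section

namespace EntireOp

/-- `ℂⁿ` with the norm `|z| = (|z₁|² + ⋯ + |zₙ|²)^{1/2}`. -/
abbrev CSpace (n : ℕ) : Type := EuclideanSpace ℂ (Fin n)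

/-- Multi-indices `α ∈ ℤ_{≥ 0}ⁿ`. -/
abbrev MultiIndex (n : ℕ) : Type := Fin n → ℕ

/-- The length `|α| = α₁ + ⋯ + αₙ`. -/
def MultiIndex.length {n : ℕ} (α : MultiIndex n) : ℕ := ∑ j, α j

/-- The factorial `α! = α₁! ⋯ αₙ!`. -/
def MultiIndex.fact {n : ℕ} (α : MultiIndex n) : ℕ := ∏ j, (α j).factorial

/-! ### The spaces of entire functions -/

/-- The `(p, τ)`-norm `‖f‖_{p,τ} = sup_z |f z| exp (-τ |z|^p)`, as an element of `[0, ∞]`. -/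
def expNorm {n : ℕ} (p τ : ℝ) (f : CSpace n → ℂ) : ℝ≥0∞ :=
  ⨆ z : CSpace n, ENNReal.ofReal (‖f z‖ * Real.exp (-τ * ‖z‖ ^ p))

theorem expNorm_zero {n : ℕ} (p τ : ℝ) : expNorm p τ (0 : CSpace n → ℂ) = 0 := by
  simp [expNorm]

theorem expNorm_add_le {n : ℕ} (p τ : ℝ) (f g : CSpace n → ℂ) :
    expNorm p τ (f + g) ≤ expNorm p τ f + expNorm p τ g := by
  refine iSup_le fun z => ?_
  calc ENNReal.ofReal (‖(f + g) z‖ * Real.exp (-τ * ‖z‖ ^ p))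
      ≤ ENNReal.ofReal (‖f z‖ * Real.exp (-τ * ‖z‖ ^ p)
          + ‖g z‖ * Real.exp (-τ * ‖z‖ ^ p)) := by
        refine ENNReal.ofReal_le_ofReal ?_
        rw [← add_mul]
        exact mul_le_mul_of_nonneg_right (norm_add_le _ _) (Real.exp_pos _).le
    _ = ENNReal.ofReal (‖f z‖ * Real.exp (-τ * ‖z‖ ^ p))
          + ENNReal.ofReal (‖g z‖ * Real.exp (-τ * ‖z‖ ^ p)) :=
        ENNReal.ofReal_add (by positivity) (by positivity)
    _ ≤ expNorm p τ f + expNorm p τ g :=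
        add_le_add (le_iSup (fun z => ENNReal.ofReal (‖f z‖ * Real.exp (-τ * ‖z‖ ^ p))) z)
          (le_iSup (fun z => ENNReal.ofReal (‖g z‖ * Real.exp (-τ * ‖z‖ ^ p))) z)

theorem expNorm_smul {n : ℕ} (p τ : ℝ) (c : ℂ) (f : CSpace n → ℂ) :
    expNorm p τ (c • f) = ENNReal.ofReal ‖c‖ * expNorm p τ f := by
  simp only [expNorm, ENNReal.mul_iSup]
  refine iSup_congr fun z => ?_
  rw [← ENNReal.ofReal_mul (norm_nonneg c), Pi.smul_apply, norm_smul, mul_assoc]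

theorem eq_zero_of_expNorm {n : ℕ} (p τ : ℝ) (f : CSpace n → ℂ) (h : expNorm p τ f = 0) :
    f = 0 := by
  funext z
  have hz : ENNReal.ofReal (‖f z‖ * Real.exp (-τ * ‖z‖ ^ p)) ≤ 0 :=
    h ▸ le_iSup (fun z => ENNReal.ofReal (‖f z‖ * Real.exp (-τ * ‖z‖ ^ p))) z
  have h0 : ‖f z‖ * Real.exp (-τ * ‖z‖ ^ p) ≤ 0 :=
    ENNReal.ofReal_eq_zero.1 (le_antisymm hz bot_le)
  have h1 : ‖f z‖ ≤ 0 := nonpos_of_mul_nonpos_left h0 (Real.exp_pos _)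
  simpa using h1

/-- Entire functions on `ℂⁿ` with finite `(p, τ)`-norm, as a space of functions. -/
def expSubmodule (n : ℕ) (p τ : ℝ) : Submodule ℂ (CSpace n → ℂ) where
  carrier := {f | Differentiable ℂ f ∧ expNorm p τ f < ∞}
  zero_mem' := ⟨differentiable_const 0, by simp [expNorm_zero]⟩
  add_mem' := fun {f g} hf hg =>
    ⟨hf.1.add hg.1, (expNorm_add_le p τ f g).trans_lt (ENNReal.add_lt_top.2 ⟨hf.2, hg.2⟩)⟩
  smul_mem' := fun c f hf =>
    ⟨hf.1.const_smul c, by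
      show expNorm p τ (c • f) < ∞
      rw [expNorm_smul]
      exact ENNReal.mul_lt_top ENNReal.ofReal_lt_top hf.2⟩

/-- The space `A_{p,τ}`. It is a separate type so that its only topology is the one of its
norm (and not that of pointwise convergence). -/
def ExpSpace (n : ℕ) (p τ : ℝ) : Type := ↥(expSubmodule n p τ)

namespace ExpSpace

variable {n : ℕ} {p τ : ℝ}

instance : AddCommGroup (ExpSpace n p τ) := inferInstanceAs (AddCommGroup ↥(expSubmodule n p τ))

instance : Module ℂ (ExpSpace n p τ) := inferInstanceAs (Module ℂ ↥(expSubmodule n p τ))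

/-- The function underlying an element of `A_{p,τ}`. -/
def toFun (f : ExpSpace n p τ) : CSpace n → ℂ := f.1

/-- `A_{p,τ}` is normed by the `(p, τ)`-norm, which is finite on it. -/
instance : Norm (ExpSpace n p τ) := ⟨fun f => (expNorm p τ f.toFun).toReal⟩

theorem core : NormedSpace.Core ℂ (ExpSpace n p τ) where
  norm_nonneg _ := ENNReal.toReal_nonneg
  norm_smul c f := by
    show (expNorm p τ (c • f.1)).toReal = ‖c‖ * (expNorm p τ f.1).toReal
    rw [expNorm_smul, ENNReal.toReal_mul, ENNReal.toReal_ofReal (norm_nonneg c)]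
  norm_triangle f g := by
    show (expNorm p τ (f.1 + g.1)).toReal ≤ (expNorm p τ f.1).toReal + (expNorm p τ g.1).toReal
    rw [← ENNReal.toReal_add f.2.2.ne g.2.2.ne]
    exact ENNReal.toReal_mono (ENNReal.add_lt_top.2 ⟨f.2.2, g.2.2⟩).ne (expNorm_add_le p τ _ _)
  norm_eq_zero_iff f := by
    constructor
    · intro h
      have h1 : (expNorm p τ f.1).toReal = 0 := h
      rcases (ENNReal.toReal_eq_zero_iff _).1 h1 with h2 | h2
      · exact Subtype.ext (eq_zero_of_expNorm p τ f.1 h2)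
      · exact absurd h2 f.2.2.ne
    · rintro rfl
      show (expNorm p τ (0 : CSpace n → ℂ)).toReal = 0
      simp [expNorm_zero]

instance : NormedAddCommGroup (ExpSpace n p τ) := NormedAddCommGroup.ofCore core

instance : NormedSpace ℂ (ExpSpace n p τ) := NormedSpace.ofCore core

end ExpSpace

/-- The intersection of the spaces `A_{p,τ}`, `τ > 0`, as a space of functions. -/
def minSubmodule (n : ℕ) (p : ℝ) : Submodule ℂ (CSpace n → ℂ) :=
  ⨅ τ : Set.Ioi (0 : ℝ), expSubmodule n p τ

/-- The space `A_{p,0}` of entire functions of order at most `p` of minimal type, as the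
projective limit (along the inclusions) of the spaces `A_{p,τ}`, `τ > 0`. -/
def MinSpace (n : ℕ) (p : ℝ) : Type := ↥(minSubmodule n p)

namespace MinSpace

variable {n : ℕ} {p : ℝ}

instance : AddCommGroup (MinSpace n p) := inferInstanceAs (AddCommGroup ↥(minSubmodule n p))

instance : Module ℂ (MinSpace n p) := inferInstanceAs (Module ℂ ↥(minSubmodule n p))

instance : CoeFun (MinSpace n p) (fun _ => CSpace n → ℂ) := ⟨fun f => f.1⟩

/-- An entire function whose `(p, τ)`-norms are all finite, as an element of `A_{p,0}`. -/
def mk (f : CSpace n → ℂ) (hf : f ∈ minSubmodule n p) : MinSpace n p := ⟨f, hf⟩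

/-- The canonical map `A_{p,0} → A_{p,τ}`. -/
def incl (τ : Set.Ioi (0 : ℝ)) : MinSpace n p →ₗ[ℂ] ExpSpace n p τ :=
  Submodule.inclusion (iInf_le (fun τ : Set.Ioi (0 : ℝ) => expSubmodule n p τ) τ)

/-- The projective limit topology: the coarsest topology for which all canonical maps
`A_{p,0} → A_{p,τ}` are continuous. -/
instance : TopologicalSpace (MinSpace n p) :=
  ⨅ τ : Set.Ioi (0 : ℝ), TopologicalSpace.induced (incl τ) inferInstance

end MinSpace

/-! ### Differential operators of infinite order -/

/-- The partial derivative `∂f/∂z_j`. -/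
def partialDeriv {n : ℕ} (j : Fin n) (f : CSpace n → ℂ) : CSpace n → ℂ :=
  fun z => fderiv ℂ f z (EuclideanSpace.single j 1)

/-- `∂^α f = (∂/∂z₁)^{α₁} ⋯ (∂/∂zₙ)^{αₙ} f`. -/
def multiDeriv {n : ℕ} (α : MultiIndex n) (f : CSpace n → ℂ) : CSpace n → ℂ :=
  (List.finRange n).foldr (fun j g => (partialDeriv j)^[α j] g) f

/-- A formal differential operator `P = ∑_α a_α(z) ∂^α` of infinite order with entire
coefficients. -/
@[ext]
structure FormalOp (n : ℕ) where
  /-- the coefficients `a_α` -/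
  coeff : MultiIndex n → CSpace n → ℂ
  entire : ∀ α, Differentiable ℂ (coeff α)

namespace FormalOp

variable {n : ℕ}

/-- The term `a_α ∂^α f` of `P f`. -/
def term (P : FormalOp n) (f : CSpace n → ℂ) (α : MultiIndex n) : CSpace n → ℂ :=
  fun z => P.coeff α z * multiDeriv α f z

/-- The function `P f = ∑_α a_α ∂^α f` (meaningful where the series converges). -/
def apply (P : FormalOp n) (f : CSpace n → ℂ) : CSpace n → ℂ :=
  fun z => ∑' α, P.term f α z

/-- First growth condition. The exponent `1 - 1 / p` is `1 / q`, where `1 / p + 1 / q = 1`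
(and `1 / q = 0` if `p = 1`). -/
def CondI (p : ℝ) (P : FormalOp n) : Prop :=
  ∀ ε : ℝ, 0 < ε → ∃ B : ℝ, 0 < B ∧ ∀ (α : MultiIndex n) (z : CSpace n),
    ‖P.coeff α z‖ ≤
      B ^ (α.length + 1) / ((α.length.factorial : ℝ) ^ (1 - 1 / p)) * Real.exp (ε * ‖z‖ ^ p)

/-- Second growth condition (with `|α| ^ (|α| / p) = 1` for `α = 0`). -/
def CondII (p : ℝ) (P : FormalOp n) : Prop :=
  ∀ ε : ℝ, 0 < ε → ∃ B : ℝ, 0 < B ∧ ∀ (α : MultiIndex n) (z : CSpace n),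
    ‖P.coeff α z‖ ≤
      (α.length : ℝ) ^ ((α.length : ℝ) / p) / (α.fact : ℝ) * B ^ (α.length + 1)
        * Real.exp (ε * ‖z‖ ^ p)

/-- Third growth condition. -/
def CondIII (p : ℝ) (P : FormalOp n) : Prop :=
  ∀ ε : ℝ, 0 < ε → ∃ B : ℝ, 0 < B ∧ ∀ α : MultiIndex n,
    expNorm p ε (P.coeff α) ≤
      ENNReal.ofReal (B ^ (α.length + 1) / ((α.length.factorial : ℝ) ^ (1 - 1 / p)))

/-- Fourth growth condition. -/
def CondIV (p : ℝ) (P : FormalOp n) : Prop :=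
  ∀ ε : ℝ, 0 < ε → ∃ B : ℝ, 0 < B ∧ ∀ α : MultiIndex n,
    expNorm p ε (P.coeff α) ≤
      ENNReal.ofReal
        ((α.length : ℝ) ^ ((α.length : ℝ) / p) / (α.fact : ℝ) * B ^ (α.length + 1))

end FormalOp

/-- The class `D_{p,0}` of formal differential operators satisfying one of the four (equivalent)
growth conditions. -/
def DClass (n : ℕ) (p : ℝ) : Set (FormalOp n) :=
  {P | P.CondI p ∨ P.CondII p ∨ P.CondIII p ∨ P.CondIV p}

end EntireOp

end

noncomputable section

namespace EntireOp

/-! ### Elementary inequalities -/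

/-! Everything rests on the duality `multiDeriv_shiftedMonomial`: at `w = z`, the derivative `∂^α`
of `(w - z)^β` is `β!` if `α = β` and `0` otherwise. Hence an operator `F` that equals some `P` must
have `a_β(z) = F((· - z)^β)(z) / β!`. This gives uniqueness (`eq_symbol`) and dictates the candidate
`symbol` for existence.

The growth conditions come from the weight `m^{m/p}`, which plays two roles. It measures a monomial
of degree `m` in the norms of `A_{p,0}` (`exists_pow_le_exp`), so boundedness of `F` between two of
these norms (`MinSpace.exists_nrm_le`) turns into condition (II) for the symbol. It is also what
Cauchy's estimate can absorb when its radius is adapted to `m` (`exists_radius`): under (II) the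
terms `a_α ∂^α f` are bounded by `2^{-|α|}` times a norm of `f` (`CondII.exists_norm_term_le`),
which yields convergence and continuity together. Conditions (I) and (II) differ by geometric
factors only, because `m^m ≤ e^m m!` and `m! ≤ n^m α!` for `m = |α|`; (III) and (IV) are (I) and
(II) with the supremum over `z` taken.

To see that `F` equals its symbol, fix `z`. The two functionals `f ↦ (F f)(z)` and `f ↦ (P f)(z)`
agree on monomials centred at `z`, hence on those centred at `0`. Both are bounded, and the
polynomials are dense because homogeneous Taylor expansions converge in every norm
(`MinSpace.tendsto_sum_homogeneousPart`). -/

theorem add_rpow_le_two_rpow_mul {p x y : ℝ} (hp : 0 < p) (hx : 0 ≤ x) (hy : 0 ≤ y) :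
    (x + y) ^ p ≤ 2 ^ p * (x ^ p + y ^ p) := by
  have hx' := Real.rpow_nonneg hx p
  have hy' := Real.rpow_nonneg hy p
  have h2 : (0 : ℝ) ≤ 2 ^ p := by positivity
  rcases le_total x y with h | h
  · calc (x + y) ^ p ≤ (2 * y) ^ p := Real.rpow_le_rpow (by positivity) (by linarith) hp.le
      _ = 2 ^ p * y ^ p := Real.mul_rpow (by norm_num) hy
      _ ≤ _ := by nlinarith
  · calc (x + y) ^ p ≤ (2 * x) ^ p := Real.rpow_le_rpow (by positivity) (by linarith) hp.le
      _ = 2 ^ p * x ^ p := Real.mul_rpow (by norm_num) hx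
      _ ≤ _ := by nlinarith

/-- The weight `m ^ (m / p)`. -/
def rootWeight (p : ℝ) (m : ℕ) : ℝ := (m : ℝ) ^ ((m : ℝ) / p)

theorem rootWeight_eq (p : ℝ) (m : ℕ) : rootWeight p m = ((m : ℝ) ^ m) ^ (1 / p) := by
  rw [rootWeight, ← Real.rpow_natCast, ← Real.rpow_mul (Nat.cast_nonneg m), mul_one_div]

theorem rootWeight_pos (p : ℝ) (m : ℕ) : 0 < rootWeight p m := by
  rw [rootWeight_eq]
  refine Real.rpow_pos_of_pos ?_ _
  rcases Nat.eq_zero_or_pos m with rfl | h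
  · simp
  · positivity

/-- Meant for Cauchy's estimate, whose bound `exp (c r^p) / r^m` is nearly minimal when `r^p` is
proportional to `m`. The constant `c` does not depend on `m`; only the radius does. -/
theorem exists_radius {p δ : ℝ} (hp : 0 < p) (hδ : 0 < δ) :
    ∃ c : ℝ, 0 < c ∧ ∀ m : ℕ, ∃ r : ℝ, 0 < r ∧
      Real.exp (c * r ^ p) * rootWeight p m ≤ Real.exp 1 * (δ * r) ^ m := by
  have he := Real.exp_pos 1
  refine ⟨(δ / Real.exp 1) ^ p, by positivity, fun m => ?_⟩
  have hm : (0 : ℝ) < (m : ℝ) + 1 := by positivity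
  -- With this radius `c r^p = m + 1` and `δ r = e (m + 1)^{1/p}`. Using `m + 1` instead of `m`
  -- keeps the radius positive at `m = 0`.
  refine ⟨((m : ℝ) + 1) ^ (1 / p) * (Real.exp 1 / δ), by positivity, ?_⟩
  have h1 : (δ / Real.exp 1) ^ p * (((m : ℝ) + 1) ^ (1 / p) * (Real.exp 1 / δ)) ^ p = m + 1 := by
    rw [← Real.mul_rpow (by positivity) (by positivity)]
    have : δ / Real.exp 1 * (((m : ℝ) + 1) ^ (1 / p) * (Real.exp 1 / δ))
        = ((m : ℝ) + 1) ^ (1 / p) := by field_simp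
    rw [this, ← Real.rpow_mul hm.le, one_div_mul_cancel hp.ne', Real.rpow_one]
  have h2 : δ * (((m : ℝ) + 1) ^ (1 / p) * (Real.exp 1 / δ))
      = Real.exp 1 * ((m : ℝ) + 1) ^ (1 / p) := by field_simp
  have h3 : (((m : ℝ) + 1) ^ (1 / p)) ^ m = (((m : ℝ) + 1) ^ m) ^ (1 / p) := by
    rw [← Real.rpow_natCast, ← Real.rpow_natCast, ← Real.rpow_mul hm.le, ← Real.rpow_mul hm.le,
      mul_comm]
  rw [h1, h2, mul_pow, h3, Real.exp_add, ← Real.exp_one_pow m, rootWeight_eq]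
  have h4 : ((m : ℝ) ^ m) ^ (1 / p) ≤ (((m : ℝ) + 1) ^ m) ^ (1 / p) := by
    refine Real.rpow_le_rpow (by positivity) ?_ (by positivity)
    gcongr
    linarith
  calc Real.exp 1 ^ m * Real.exp 1 * ((m : ℝ) ^ m) ^ (1 / p)
      ≤ Real.exp 1 ^ m * Real.exp 1 * (((m : ℝ) + 1) ^ m) ^ (1 / p) := by gcongr
    _ = _ := by ring

/-- Take the `p`-th root of `x^m ≤ m! e^x ≤ m^m e^x` at `x = p c t^p`. -/
theorem exists_pow_le_exp {p c : ℝ} (hp : 0 < p) (hc : 0 < c) :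
    ∃ K : ℝ, 0 < K ∧ ∀ (m : ℕ) (t : ℝ), 0 ≤ t →
      t ^ m ≤ K ^ m * rootWeight p m * Real.exp (c * t ^ p) := by
  refine ⟨(1 / (p * c)) ^ (1 / p), by positivity, fun m t ht => ?_⟩
  have hx : 0 ≤ p * c * t ^ p := by positivity
  have h1 : (p * c * t ^ p) ^ m ≤ (m : ℝ) ^ m * Real.exp (p * c * t ^ p) := by
    have := Real.pow_div_factorial_le_exp _ hx m
    rw [div_le_iff₀ (by positivity)] at this
    have h2 : (m.factorial : ℝ) ≤ (m : ℝ) ^ m := by exact_mod_cast Nat.factorial_le_pow m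
    nlinarith [Real.exp_pos (p * c * t ^ p)]
  have h2 : (t ^ p) ^ m ≤ (1 / (p * c)) ^ m * ((m : ℝ) ^ m * Real.exp (p * c * t ^ p)) := by
    calc (t ^ p) ^ m = (1 / (p * c)) ^ m * (p * c * t ^ p) ^ m := by
          rw [← mul_pow]; congr 1; field_simp
      _ ≤ _ := by gcongr
  have h3 := Real.rpow_le_rpow (by positivity) h2 (by positivity : 0 ≤ 1 / p)
  rw [Real.mul_rpow (by positivity) (by positivity), Real.mul_rpow (by positivity) (by positivity),
    ← rootWeight_eq, ← Real.exp_mul] at h3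
  have e1 : ((t ^ p) ^ m) ^ (1 / p) = t ^ m := by
    rw [← Real.rpow_natCast (t ^ p), ← Real.rpow_mul ht, ← Real.rpow_mul ht, ← Real.rpow_natCast]
    congr 1
    field_simp
  have e2 : ((1 / (p * c)) ^ m) ^ (1 / p) = ((1 / (p * c)) ^ (1 / p)) ^ m := by
    have : (0 : ℝ) ≤ 1 / (p * c) := by positivity
    rw [← Real.rpow_natCast, ← Real.rpow_natCast, ← Real.rpow_mul this, ← Real.rpow_mul this,
      mul_comm (m : ℝ)]
  have e3 : p * c * t ^ p * (1 / p) = c * t ^ p := by field_simp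
  rwa [e1, e2, e3, ← mul_assoc] at h3

/-! ### Factorials of multi-indices, comparison of the weights, summation over multi-indices -/

theorem MultiIndex.fact_pos {n : ℕ} (α : MultiIndex n) : 0 < α.fact :=
  Finset.prod_pos fun _ _ => Nat.factorial_pos _

theorem MultiIndex.fact_le {n : ℕ} (α : MultiIndex n) : α.fact ≤ α.length.factorial :=
  Nat.le_of_dvd (Nat.factorial_pos _) (Nat.prod_factorial_dvd_factorial_sum _ _)

/-- The quotient `|α|! / α!` is a multinomial coefficient, hence at most the sum `n^{|α|}` of all of
them, which is the expansion of `(1 + ⋯ + 1)^{|α|}`. -/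
theorem MultiIndex.factorial_length_le {n : ℕ} (α : MultiIndex n) :
    α.length.factorial ≤ n ^ α.length * α.fact := by
  rw [← show α.fact * Nat.multinomial Finset.univ α = α.length.factorial from
    Nat.multinomial_spec Finset.univ α, mul_comm]
  refine Nat.mul_le_mul_right _ ?_
  have h := Finset.sum_pow_eq_sum_piAntidiag (R := ℕ) (Finset.univ : Finset (Fin n))
    (fun _ => 1) α.length
  simp only [Finset.sum_const, Finset.card_univ, Fintype.card_fin, smul_eq_mul, mul_one, one_pow,
    Finset.prod_const_one, Nat.cast_id] at h
  rw [h]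
  refine Finset.single_le_sum (f := fun k => Nat.multinomial Finset.univ k) (fun _ _ => Nat.zero_le _) ?_
  simp [Finset.mem_piAntidiag, MultiIndex.length]

theorem factorialWeight_le {n : ℕ} {p : ℝ} (hp : 0 < p) (α : MultiIndex n) :
    1 / ((α.length.factorial : ℝ) ^ (1 - 1 / p)) ≤ rootWeight p α.length / α.fact := by
  have hm : (0 : ℝ) < α.length.factorial := by positivity
  have hf : (0 : ℝ) < α.fact := by exact_mod_cast α.fact_pos
  rw [Real.rpow_sub hm, Real.rpow_one, one_div_div, rootWeight_eq]
  have h1 : (α.length.factorial : ℝ) ≤ (α.length : ℝ) ^ α.length := by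
    exact_mod_cast Nat.factorial_le_pow _
  have h2 : (α.fact : ℝ) ≤ α.length.factorial := by exact_mod_cast α.fact_le
  gcongr

theorem rootWeight_div_fact_le {n : ℕ} {p : ℝ} (hp : 0 < p) (α : MultiIndex n) :
    rootWeight p α.length / α.fact ≤
      (Real.exp 1 ^ (1 / p) * n) ^ α.length * (1 / ((α.length.factorial : ℝ) ^ (1 - 1 / p))) := by
  have hm : (0 : ℝ) < α.length.factorial := by positivity
  have hf : (0 : ℝ) < α.fact := by exact_mod_cast α.fact_pos
  have he := Real.exp_pos 1
  rw [Real.rpow_sub hm, Real.rpow_one, one_div_div, rootWeight_eq]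
  have h1 : ((α.length : ℝ) ^ α.length) ^ (1 / p) ≤
      (Real.exp 1 ^ (1 / p)) ^ α.length * (α.length.factorial : ℝ) ^ (1 / p) := by
    have h := Real.pow_div_factorial_le_exp (α.length : ℝ) (Nat.cast_nonneg _) α.length
    rw [div_le_iff₀ hm, ← Real.exp_one_pow] at h
    calc _ ≤ (Real.exp 1 ^ α.length * α.length.factorial) ^ (1 / p) :=
          Real.rpow_le_rpow (by positivity) h (by positivity)
      _ = _ := by
          rw [Real.mul_rpow (by positivity) hm.le, ← Real.rpow_natCast, ← Real.rpow_natCast,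
            ← Real.rpow_mul he.le, ← Real.rpow_mul he.le, mul_comm (1 / p)]
  have h2 : (α.length.factorial : ℝ) ≤ n ^ α.length * α.fact := by
    exact_mod_cast α.factorial_length_le
  rw [← mul_div_assoc, div_le_div_iff₀ hf hm, mul_pow]
  calc _ ≤ ((Real.exp 1 ^ (1 / p)) ^ α.length * (α.length.factorial : ℝ) ^ (1 / p))
        * (n ^ α.length * α.fact) := by gcongr
    _ = _ := by ring

/-- A finite set of multi-indices lies in a box, over which the sum factors into `n` truncated
geometric series. -/
theorem summable_pow_length (n : ℕ) {θ : ℝ} (h0 : 0 ≤ θ) (h1 : θ < 1) :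
    Summable fun α : MultiIndex n => θ ^ α.length := by
  classical
  refine summable_of_sum_le (c := ((1 - θ)⁻¹) ^ n) (fun α => by positivity) fun u => ?_
  let N : ℕ := u.sup MultiIndex.length + 1
  have hu : u ⊆ Fintype.piFinset fun _ : Fin n => Finset.range N := by
    intro α hα
    refine Fintype.mem_piFinset.2 fun j => Finset.mem_range.2 (Nat.lt_succ_of_le ?_)
    exact (Finset.single_le_sum (f := α) (fun _ _ => Nat.zero_le _) (Finset.mem_univ j)).trans
      (Finset.le_sup (f := MultiIndex.length) hα)
  calc ∑ α ∈ u, θ ^ α.length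
      ≤ ∑ α ∈ Fintype.piFinset fun _ : Fin n => Finset.range N, θ ^ MultiIndex.length α :=
        Finset.sum_le_sum_of_subset_of_nonneg hu fun _ _ _ => by positivity
    _ = ∏ _j : Fin n, ∑ k ∈ Finset.range N, θ ^ k := by
        rw [Finset.prod_univ_sum]
        refine Finset.sum_congr rfl fun α _ => ?_
        rw [MultiIndex.length, Finset.prod_pow_eq_pow_sum]
    _ ≤ ∏ _j : Fin n, (1 - θ)⁻¹ := by
        refine Finset.prod_le_prod (fun _ _ => by positivity) fun _ _ => ?_
        rw [← tsum_geometric_of_lt_one h0 h1]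
        exact (summable_geometric_of_lt_one h0 h1).sum_le_tsum _ fun _ _ => by positivity
    _ = _ := by simp

/-! ### Entire functions of several variables -/

section Cauchy

variable {n : ℕ} {f : CSpace n → ℂ}

theorem differentiable_line (hf : Differentiable ℂ f) (z v : CSpace n) :
    Differentiable ℂ fun t : ℂ => f (z + t • v) :=
  hf.comp ((differentiable_const z).add (differentiable_id.smul_const v))

theorem deriv_line (hf : Differentiable ℂ f) (z v : CSpace n) (t : ℂ) :
    deriv (fun t : ℂ => f (z + t • v)) t = fderiv ℂ f (z + t • v) v := by
  have h1 : HasDerivAt (fun t : ℂ => z + t • v) v t := by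
    simpa using ((hasDerivAt_id t).smul_const v).const_add z
  exact ((hf (z + t • v)).hasFDerivAt.comp_hasDerivAt t h1).deriv

/-- One-variable Cauchy estimate on the complex line through `z` in direction `v`, on the circle of
radius `r / ‖v‖`. -/
theorem norm_fderiv_le (hf : Differentiable ℂ f) {z : CSpace n} {r M : ℝ} (hr : 0 < r)
    (hM : ∀ w, ‖w - z‖ ≤ r → ‖f w‖ ≤ M) : ‖fderiv ℂ f z‖ ≤ M / r := by
  have hM0 : 0 ≤ M := (norm_nonneg _).trans (hM z (by simp [hr.le]))
  refine ContinuousLinearMap.opNorm_le_bound _ (by positivity) fun v => ?_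
  rcases eq_or_ne v 0 with rfl | hv
  · simp
  have hv' : 0 < ‖v‖ := norm_pos_iff.2 hv
  have h := deriv_line hf z v 0
  rw [zero_smul, add_zero] at h
  rw [← h]
  have := Complex.norm_deriv_le_of_forall_mem_sphere_norm_le (c := 0) (R := r / ‖v‖) (C := M)
    (f := fun t : ℂ => f (z + t • v)) (by positivity)
    (differentiable_line hf z v).diffContOnCl fun t ht => hM _ ?_
  · calc _ ≤ M / (r / ‖v‖) := this
      _ = M / r * ‖v‖ := by field_simp
  · rw [mem_sphere_zero_iff_norm] at ht
    rw [add_sub_cancel_left, norm_smul, ht, div_mul_cancel₀ _ hv'.ne']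

theorem exists_norm_le_on_ball (hf : Differentiable ℂ f) (R : ℝ) :
    ∃ M : ℝ, 0 ≤ M ∧ ∀ w, ‖w‖ ≤ R → ‖f w‖ ≤ M := by
  obtain ⟨M, hM⟩ := (isCompact_closedBall (0 : CSpace n) R).exists_bound_of_continuousOn
    hf.continuous.continuousOn
  exact ⟨max M 0, le_max_right _ _, fun w hw => (hM w (by simpa using hw)).trans (le_max_left _ _)⟩

theorem partialDeriv_eq_circleIntegral (hf : Differentiable ℂ f) (j : Fin n) (z : CSpace n) :
    partialDeriv j f z = (2 * Real.pi * Complex.I)⁻¹ *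
      ∮ t in C(0, 1), (1 / t ^ 2) • f (z + t • EuclideanSpace.single j 1) := by
  have h := (differentiable_line hf z (EuclideanSpace.single j 1)).differentiableOn
    |>.deriv_eq_smul_circleIntegral (c := 0) (R := 1) one_pos
  rw [deriv_line hf, zero_smul, add_zero] at h
  simp only [sub_zero] at h
  rw [h, smul_eq_mul, inv_mul_cancel_left₀ Complex.two_pi_I_ne_zero, partialDeriv]

/-- Cauchy's formula writes the partial derivative as a circle integral of values of `f`, which can
be differentiated in `z` under the integral sign; the dominating constant comes from
`norm_fderiv_le`. -/
theorem differentiable_partialDeriv (hf : Differentiable ℂ f) (j : Fin n) :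
    Differentiable ℂ (partialDeriv j f) := by
  rw [funext (partialDeriv_eq_circleIntegral hf j)]
  refine Differentiable.const_mul (fun z₀ => ?_) _
  have hv : ‖(EuclideanSpace.single j 1 : CSpace n)‖ = 1 := by simp
  generalize (EuclideanSpace.single j 1 : CSpace n) = v at hv
  -- The `3` collects three unit displacements: `z` in the ball about `z₀`, the point on the circle
  -- of integration, and the radius of the Cauchy estimate for `fderiv`.
  obtain ⟨M, hM0, hM⟩ := exists_norm_le_on_ball hf (‖z₀‖ + 3)
  simp only [circleIntegral, intervalIntegral.integral_of_le Real.two_pi_pos.le]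
  have hcm : ∀ θ : ℝ, ‖circleMap 0 1 θ‖ = 1 := fun θ => by simp
  have hcont : ∀ z : CSpace n, Continuous fun θ : ℝ =>
      deriv (circleMap 0 1) θ • (1 / circleMap 0 1 θ ^ 2) • f (z + circleMap 0 1 θ • v) := by
    intro z
    simp only [deriv_circleMap, smul_eq_mul]
    have h1 : Continuous (circleMap 0 1) := continuous_circleMap 0 1
    refine (h1.mul continuous_const).mul (Continuous.mul ?_ ?_)
    · exact continuous_const.div (h1.pow 2) fun θ => pow_ne_zero _ (by
        rw [← norm_pos_iff, hcm]; exact one_pos)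
    · exact hf.continuous.comp (continuous_const.add (h1.smul continuous_const))
  refine (hasFDerivAt_integral_of_dominated_of_fderiv_le (𝕜 := ℂ) (s := Metric.ball z₀ 1)
    (bound := fun _ => M)
    (F' := fun z θ => (deriv (circleMap 0 1) θ * (1 / circleMap 0 1 θ ^ 2)) •
      fderiv ℂ f (z + circleMap 0 1 θ • v)) (Metric.ball_mem_nhds _ one_pos)
    (Filter.Eventually.of_forall fun z => (hcont z).aestronglyMeasurable) ?_ ?_ ?_ ?_
    ?_).differentiableAt
  · exact (hcont z₀).integrableOn_Ioc
  · have h1 : Measurable (circleMap 0 1) := (continuous_circleMap 0 1).measurable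
    have h2 : Measurable fun θ : ℝ => deriv (circleMap 0 1) θ * (1 / circleMap 0 1 θ ^ 2) := by
      simp only [deriv_circleMap]
      exact (h1.mul measurable_const).mul (measurable_const.div (h1.pow_const 2))
    have h3 : Measurable fun θ : ℝ => z₀ + circleMap 0 1 θ • v :=
      (continuous_const.add ((continuous_circleMap 0 1).smul continuous_const)).measurable
    -- Continuity of `fderiv ℂ f` is not known at this stage; its measurability suffices.
    exact h2.aestronglyMeasurable.smul
      ((measurable_fderiv ℂ f).comp h3).aestronglyMeasurable
  · refine Filter.Eventually.of_forall fun θ z hz => ?_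
    have hb : ‖fderiv ℂ f (z + circleMap 0 1 θ • v)‖ ≤ M / 1 := by
      refine norm_fderiv_le hf one_pos fun w hw => hM w ?_
      have e : w = (w - (z + circleMap 0 1 θ • v)) + (z - z₀) + circleMap 0 1 θ • v + z₀ := by abel
      have hz' : ‖z - z₀‖ ≤ 1 := (mem_ball_iff_norm.1 hz).le
      have h4 : ‖circleMap 0 1 θ • v‖ = 1 := by rw [norm_smul, hcm, hv, one_mul]
      rw [e]
      refine (norm_add_le _ _).trans ?_
      have := norm_add₃_le (a := w - (z + circleMap 0 1 θ • v)) (b := z - z₀)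
        (c := circleMap 0 1 θ • v)
      linarith
    have hs : ‖deriv (circleMap 0 1) θ * (1 / circleMap 0 1 θ ^ 2)‖ = 1 := by
      simp [deriv_circleMap]
    rw [norm_smul, hs, one_mul]
    simpa using hb
  · exact MeasureTheory.integrable_const _
  · refine Filter.Eventually.of_forall fun θ z _ => ?_
    have h1 : HasFDerivAt (fun z : CSpace n => f (z + circleMap 0 1 θ • v))
        (fderiv ℂ f (z + circleMap 0 1 θ • v)) z :=
      (hf _).hasFDerivAt.comp z ((hasFDerivAt_id z).add_const _)
    have h2 := h1.const_smul (deriv (circleMap 0 1) θ * (1 / circleMap 0 1 θ ^ 2))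
    refine h2.congr_of_eventuallyEq (Filter.Eventually.of_forall fun z => ?_)
    simp only [Pi.smul_apply, smul_eq_mul, mul_assoc]

theorem differentiable_partialDeriv_iterate (hf : Differentiable ℂ f) (j : Fin n) (k : ℕ) :
    Differentiable ℂ ((partialDeriv j)^[k] f) := by
  induction k with
  | zero => exact hf
  | succ k ih => rw [Function.iterate_succ_apply']; exact differentiable_partialDeriv ih j

theorem differentiable_foldr (hf : Differentiable ℂ f) (α : MultiIndex n) (l : List (Fin n)) :
    Differentiable ℂ (l.foldr (fun j g => (partialDeriv j)^[α j] g) f) := by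
  induction l with
  | nil => exact hf
  | cons j l ih => exact differentiable_partialDeriv_iterate ih j _

theorem differentiable_multiDeriv (hf : Differentiable ℂ f) (α : MultiIndex n) :
    Differentiable ℂ (multiDeriv α f) :=
  differentiable_foldr hf α _

theorem partialDeriv_iterate_line (hf : Differentiable ℂ f) (j : Fin n) (k : ℕ) (z : CSpace n) :
    iteratedDeriv k (fun t : ℂ => f (z + t • EuclideanSpace.single j 1)) =
      fun t => (partialDeriv j)^[k] f (z + t • EuclideanSpace.single j 1) := by
  induction k with
  | zero => simp
  | succ k ih =>
    rw [iteratedDeriv_succ, ih]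
    funext t
    rw [deriv_line (differentiable_partialDeriv_iterate hf j k), Function.iterate_succ_apply',
      partialDeriv]

theorem norm_partialDeriv_iterate_le (hf : Differentiable ℂ f) (j : Fin n) (k : ℕ)
    {z : CSpace n} {r M : ℝ} (hr : 0 < r) (hM : ∀ w, ‖w - z‖ ≤ r → ‖f w‖ ≤ M) :
    ‖(partialDeriv j)^[k] f z‖ ≤ k.factorial * M / r ^ k := by
  have h := Complex.norm_iteratedDeriv_le_of_forall_mem_sphere_norm_le (c := 0) (C := M) k hr
    (differentiable_line hf z (EuclideanSpace.single j 1)).diffContOnCl fun t ht => hM _ ?_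
  · rw [partialDeriv_iterate_line hf] at h
    simpa using h
  · rw [mem_sphere_zero_iff_norm] at ht
    simp [norm_smul, ht]

/-- Each variable in the list costs one Cauchy estimate of radius `r`, so the point moves by at most
`r` per entry. -/
theorem norm_foldr_le (hf : Differentiable ℂ f) (α : MultiIndex n) (l : List (Fin n))
    {r M : ℝ} (hr : 0 < r) (z : CSpace n)
    (hM : ∀ w, ‖w - z‖ ≤ l.length * r → ‖f w‖ ≤ M) :
    ‖l.foldr (fun j g => (partialDeriv j)^[α j] g) f z‖ ≤
      (l.map fun j => ((α j).factorial : ℝ) / r ^ α j).prod * M := by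
  induction l generalizing z with
  | nil => simpa using hM z (by simp)
  | cons j l ih =>
    have h := norm_partialDeriv_iterate_le (differentiable_foldr hf α l) j (α j) (z := z) hr
      fun w hw => ih w fun u hu => hM u ?_
    · simp only [List.foldr_cons, List.map_cons, List.prod_cons]
      refine h.trans (le_of_eq (by ring))
    · have := norm_sub_le_norm_sub_add_norm_sub u w z
      push_cast [List.length_cons]
      linarith

theorem norm_multiDeriv_le (hf : Differentiable ℂ f) (α : MultiIndex n)
    {r M : ℝ} (hr : 0 < r) (z : CSpace n)
    (hM : ∀ w, ‖w - z‖ ≤ n * r → ‖f w‖ ≤ M) :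
    ‖multiDeriv α f z‖ ≤ α.fact / r ^ α.length * M := by
  have h := norm_foldr_le hf α (List.finRange n) hr z (by simpa using hM)
  rwa [← List.ofFn_eq_map, List.prod_ofFn, Finset.prod_div_distrib, Finset.prod_pow_eq_pow_sum,
    ← Nat.cast_prod] at h

/-- A series of entire functions with a locally bounded majorant is entire. -/
theorem differentiable_tsum_of_norm_le {ι : Type*} {g : ι → CSpace n → ℂ} {u : ι → ℝ}
    (hu : Summable u) (hg : ∀ i, Differentiable ℂ (g i)) (B : ℝ → ℝ)
    (hB : ∀ R i w, ‖w‖ ≤ R → ‖g i w‖ ≤ u i * B R) :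
    Differentiable ℂ fun z => ∑' i, g i z := by
  intro z
  -- Cauchy estimates of radius `1` at points of the unit ball about `z` stay within norm `‖z‖ + 2`,
  -- so the majorant of the terms also dominates their derivatives.
  refine (hasFDerivAt_tsum_of_isPreconnected (u := fun i => u i * B (‖z‖ + 2))
    (s := Metric.ball z 1) (f' := fun i w => fderiv ℂ (g i) w) (x₀ := z) (hu.mul_right _)
    Metric.isOpen_ball (convex_ball z 1).isPreconnected
    (fun i w _ => (hg i w).hasFDerivAt) (fun i w hw => ?_)
    (Metric.mem_ball_self one_pos) ?_ (Metric.mem_ball_self one_pos)).differentiableAt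
  · have := norm_fderiv_le (hg i) (z := w) (M := u i * B (‖z‖ + 2)) one_pos
      fun v hv => hB _ i v ?_
    · simpa using this
    · have h1 : ‖w - z‖ < 1 := mem_ball_iff_norm.1 hw
      have e : v = (v - w) + (w - z) + z := by abel
      rw [e]
      have := norm_add₃_le (a := v - w) (b := w - z) (c := z)
      linarith
  · exact .of_norm_bounded (hu.mul_right (B ‖z‖)) fun i => hB _ i z le_rfl

end Cauchy

/-! ### The space `A_{p,0}` -/

theorem expNorm_le_ofReal_iff {n : ℕ} {p τ C : ℝ} (hC : 0 ≤ C) {f : CSpace n → ℂ} :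
    expNorm p τ f ≤ ENNReal.ofReal C ↔ ∀ z, ‖f z‖ ≤ C * Real.exp (τ * ‖z‖ ^ p) := by
  refine iSup_le_iff.trans (forall_congr' fun z => ?_)
  rw [ENNReal.ofReal_le_ofReal_iff hC, neg_mul, Real.exp_neg, ← div_eq_mul_inv,
    div_le_iff₀ (Real.exp_pos _)]

theorem mem_minSubmodule {n : ℕ} {p : ℝ} {f : CSpace n → ℂ} (hf : Differentiable ℂ f)
    (h : ∀ τ : ℝ, 0 < τ → ∃ C, ∀ z, ‖f z‖ ≤ C * Real.exp (τ * ‖z‖ ^ p)) :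
    f ∈ minSubmodule n p := by
  refine Submodule.mem_iInf _ |>.2 fun τ => ⟨hf, ?_⟩
  obtain ⟨C, hC⟩ := h τ τ.2
  have hC0 : 0 ≤ C := nonneg_of_mul_nonneg_left ((norm_nonneg _).trans (hC 0)) (Real.exp_pos _)
  exact ((expNorm_le_ofReal_iff hC0).2 hC).trans_lt ENNReal.ofReal_lt_top

namespace MinSpace

variable {n : ℕ} {p : ℝ}

theorem differentiable (f : MinSpace n p) : Differentiable ℂ f.1 :=
  ((Submodule.mem_iInf _).1 f.2 ⟨1, Set.mem_Ioi.2 one_pos⟩).1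

/-- The norm of `A_{p,τ}` on `A_{p,0}`. -/
def nrm (τ : Set.Ioi (0 : ℝ)) (f : MinSpace n p) : ℝ := ‖incl τ f‖

theorem nrm_nonneg (τ : Set.Ioi (0 : ℝ)) (f : MinSpace n p) : 0 ≤ nrm τ f := norm_nonneg _

theorem nrm_le_iff {τ : Set.Ioi (0 : ℝ)} {f : MinSpace n p} {C : ℝ} (hC : 0 ≤ C) :
    nrm τ f ≤ C ↔ ∀ z, ‖f z‖ ≤ C * Real.exp (τ * ‖z‖ ^ p) := by
  rw [← expNorm_le_ofReal_iff hC]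
  exact (ENNReal.le_ofReal_iff_toReal_le ((Submodule.mem_iInf _).1 f.2 τ).2.ne hC).symm

theorem norm_apply_le (τ : Set.Ioi (0 : ℝ)) (f : MinSpace n p) (z : CSpace n) :
    ‖f z‖ ≤ nrm τ f * Real.exp (τ * ‖z‖ ^ p) :=
  (nrm_le_iff (nrm_nonneg τ f)).1 le_rfl z

theorem nrm_anti {σ τ : Set.Ioi (0 : ℝ)} (h : σ ≤ τ) (f : MinSpace n p) : nrm τ f ≤ nrm σ f := by
  refine (nrm_le_iff (nrm_nonneg σ f)).2 fun z => (norm_apply_le σ f z).trans ?_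
  have h' : (σ : ℝ) ≤ τ := h
  have := nrm_nonneg σ f
  gcongr

theorem nrm_smul (τ : Set.Ioi (0 : ℝ)) (c : ℂ) (f : MinSpace n p) :
    nrm τ (c • f) = ‖c‖ * nrm τ f := by
  rw [nrm, map_smul, norm_smul, nrm]

theorem sum_apply {ι : Type*} (s : Finset ι) (f : ι → MinSpace n p) (z : CSpace n) :
    (∑ i ∈ s, f i : MinSpace n p) z = ∑ i ∈ s, f i z := by
  have h : (∑ i ∈ s, f i : MinSpace n p).1 = ∑ i ∈ s, (f i).1 :=
    map_sum (minSubmodule n p).subtype f s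
  rw [h, Finset.sum_apply]

/-- Evaluation at a point, as a linear functional. -/
def eval (z : CSpace n) : MinSpace n p →ₗ[ℂ] ℂ :=
  (LinearMap.proj z).comp (minSubmodule n p).subtype

theorem tendsto_nhds_iff {ι : Type*} {l : Filter ι} {u : ι → MinSpace n p} {f : MinSpace n p} :
    Filter.Tendsto u l (nhds f) ↔
      ∀ τ : Set.Ioi (0 : ℝ), Filter.Tendsto (fun i => nrm τ (u i - f)) l (nhds 0) := by
  rw [nhds_iInf, Filter.tendsto_iInf]
  refine forall_congr' fun τ => ?_
  rw [nhds_induced, Filter.tendsto_comap_iff, tendsto_iff_norm_sub_tendsto_zero]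
  simp only [nrm, map_sub, Function.comp_def]

/-- A continuous linear operator on `A_{p,0}` is bounded with respect to the defining norms. -/
theorem exists_nrm_le (F : MinSpace n p →L[ℂ] MinSpace n p) (σ : Set.Ioi (0 : ℝ)) :
    ∃ (τ : Set.Ioi (0 : ℝ)) (C : ℝ), 0 < C ∧ ∀ f, nrm σ (F f) ≤ C * nrm τ f := by
  by_contra! h
  have hpos : ∀ k : ℕ, (0 : ℝ) < 1 / ((k : ℝ) + 1) := fun k => by positivity
  -- The `k`-th counterexample violates the bound with constant `k + 1` for the norm of index `1 /
  -- (k + 1)`. These norms increase as the index decreases, so they eventually dominate any given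
  -- one.
  choose f hf using fun k : ℕ => h ⟨1 / ((k : ℝ) + 1), hpos k⟩ ((k : ℝ) + 1) (by positivity)
  have hFpos : ∀ k, 0 < nrm σ (F (f k)) := fun k =>
    lt_of_le_of_lt (mul_nonneg (by positivity) (nrm_nonneg _ _)) (hf k)
  -- Normalised so that every `F (g k)` has `σ`-norm `1`, while `g k` tends to `0` in each norm.
  let g : ℕ → MinSpace n p := fun k => ((nrm σ (F (f k)))⁻¹ : ℂ) • f k
  have hg : Filter.Tendsto g Filter.atTop (nhds 0) := by
    refine tendsto_nhds_iff.2 fun τ => ?_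
    refine squeeze_zero' (Filter.Eventually.of_forall fun _ => nrm_nonneg _ _) ?_
      (tendsto_one_div_add_atTop_nhds_zero_nat (𝕜 := ℝ))
    have hτ : (0 : ℝ) < τ := τ.2
    filter_upwards [(tendsto_one_div_add_atTop_nhds_zero_nat (𝕜 := ℝ)).eventually_lt_const hτ]
      with k hk
    rw [sub_zero, nrm_smul]
    have h1 : nrm τ (f k) ≤ nrm ⟨1 / ((k : ℝ) + 1), hpos k⟩ (f k) := nrm_anti hk.le _
    have h2 : ‖((nrm σ (F (f k)))⁻¹ : ℂ)‖ = (nrm σ (F (f k)))⁻¹ := by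
      rw [norm_inv, Complex.norm_real, Real.norm_of_nonneg (hFpos k).le]
    rw [h2, inv_mul_le_iff₀ (hFpos k), mul_one_div, le_div_iff₀ (by positivity), mul_comm]
    exact (mul_le_mul_of_nonneg_left h1 (by positivity)).trans (hf k).le
  have hFg := tendsto_nhds_iff.1 ((F.continuous.tendsto 0).comp hg) σ
  have h1 : ∀ k, nrm σ ((F ∘ g) k - F 0) = 1 := fun k => by
    rw [map_zero, sub_zero, Function.comp_apply, map_smul, nrm_smul, norm_inv, Complex.norm_real,
      Real.norm_of_nonneg (hFpos k).le, inv_mul_cancel₀ (hFpos k).ne']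
  simp only [h1] at hFg
  exact one_ne_zero (tendsto_nhds_unique tendsto_const_nhds hFg)

/-- A linear operator that is bounded with respect to the defining norms is continuous. -/
theorem continuous_of_nrm_le (T : MinSpace n p →ₗ[ℂ] MinSpace n p)
    (h : ∀ σ : Set.Ioi (0 : ℝ), ∃ (τ : Set.Ioi (0 : ℝ)) (C : ℝ), ∀ f, nrm σ (T f) ≤ C * nrm τ f) :
    Continuous T := by
  refine continuous_iff_continuousAt.2 fun f => tendsto_nhds_iff.2 fun σ => ?_
  obtain ⟨τ, C, hC⟩ := h σ
  have h1 := (tendsto_nhds_iff.1 (Filter.tendsto_id (x := nhds f)) τ).const_mul C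
  rw [mul_zero] at h1
  refine squeeze_zero (fun _ => nrm_nonneg _ _) (fun g => ?_) h1
  rw [← map_sub]
  exact hC _

end MinSpace

/-! ### Operators of class `D_{p,0}` -/

namespace FormalOp

variable {n : ℕ} {p : ℝ} {P : FormalOp n}

theorem condIII_iff : P.CondIII p ↔ P.CondI p := by
  refine forall_congr' fun ε => imp_congr_right fun _ => exists_congr fun B =>
    and_congr_right fun hB => forall_congr' fun α => ?_
  exact expNorm_le_ofReal_iff (by positivity)

theorem condIV_iff : P.CondIV p ↔ P.CondII p := by
  refine forall_congr' fun ε => imp_congr_right fun _ => exists_congr fun B =>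
    and_congr_right fun hB => forall_congr' fun α => ?_
  exact expNorm_le_ofReal_iff (by positivity)

theorem CondI.condII (hp : 0 < p) (h : P.CondI p) : P.CondII p := by
  intro ε hε
  obtain ⟨B, hB, h⟩ := h ε hε
  refine ⟨B, hB, fun α z => (h α z).trans ?_⟩
  have := factorialWeight_le hp α
  rw [← rootWeight]
  calc _ = 1 / ((α.length.factorial : ℝ) ^ (1 - 1 / p)) * B ^ (α.length + 1)
        * Real.exp (ε * ‖z‖ ^ p) := by ring
    _ ≤ _ := by gcongr

theorem CondII.condI (hp : 0 < p) (h : P.CondII p) : P.CondI p := by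
  intro ε hε
  obtain ⟨B, hB, h⟩ := h ε hε
  have hK : (0 : ℝ) ≤ Real.exp 1 ^ (1 / p) * n := by positivity
  -- The `+ 1` keeps the new constant positive when `n = 0` and lets a power `|α|` be replaced by
  -- `|α| + 1`.
  refine ⟨(Real.exp 1 ^ (1 / p) * n + 1) * B, by positivity, fun α z => (h α z).trans ?_⟩
  have h1 := rootWeight_div_fact_le hp α
  rw [← rootWeight]
  generalize Real.exp 1 ^ (1 / p) * (n : ℝ) = K at *
  have h2 : K ^ α.length ≤ (K + 1) ^ (α.length + 1) := by
    calc K ^ α.length ≤ (K + 1) ^ α.length := by gcongr; linarith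
      _ ≤ (K + 1) ^ (α.length + 1) := pow_le_pow_right₀ (by linarith) (Nat.le_succ _)
  calc _ ≤ K ^ α.length * (1 / ((α.length.factorial : ℝ) ^ (1 - 1 / p))) * B ^ (α.length + 1)
        * Real.exp (ε * ‖z‖ ^ p) := by gcongr
    _ ≤ (K + 1) ^ (α.length + 1) * (1 / ((α.length.factorial : ℝ) ^ (1 - 1 / p)))
        * B ^ (α.length + 1) * Real.exp (ε * ‖z‖ ^ p) := by gcongr
    _ = _ := by rw [mul_pow]; ring

theorem cond_tfae (hp : 0 < p) (P : FormalOp n) :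
    [P.CondI p, P.CondII p, P.CondIII p, P.CondIV p].TFAE := by
  tfae_have 1 → 2 := CondI.condII hp
  tfae_have 2 → 1 := CondII.condI hp
  tfae_have 3 ↔ 1 := condIII_iff
  tfae_have 4 ↔ 2 := condIV_iff
  tfae_finish

theorem mem_dClass_iff (hp : 0 < p) : P ∈ DClass n p ↔ P.CondII p := by
  have h := cond_tfae hp P
  have h1 : P.CondI p ↔ P.CondII p := h.out 0 1
  have h3 : P.CondIII p ↔ P.CondII p := h.out 2 1
  have h4 : P.CondIV p ↔ P.CondII p := h.out 3 1
  simp [DClass, h1, h3, h4]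

theorem differentiable_term (P : FormalOp n) {f : CSpace n → ℂ} (hf : Differentiable ℂ f)
    (α : MultiIndex n) : Differentiable ℂ (P.term f α) :=
  (P.entire α).mul (differentiable_multiDeriv hf α)

/-- The terms of `P f` decay geometrically in the norms of `A_{p,0}`. -/
theorem CondII.exists_norm_term_le (hp : 0 < p) (h : P.CondII p) {σ : ℝ} (hσ : 0 < σ) :
    ∃ (τ : Set.Ioi (0 : ℝ)) (C : ℝ), 0 ≤ C ∧ ∀ (f : MinSpace n p) (α : MultiIndex n)
      (z : CSpace n), ‖P.term f α z‖ ≤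
        (1 / 2) ^ α.length * (C * MinSpace.nrm τ f * Real.exp (σ * ‖z‖ ^ p)) := by
  -- Half of `σ` is spent on the coefficient, the other half on the derivative of `f`.
  obtain ⟨B, hB, hPB⟩ := h (σ / 2) (by positivity)
  -- This `δ` makes the Cauchy radius cancel `B^{|α|}` and leave `2^{-|α|}`.
  obtain ⟨c, hc, hr⟩ := exists_radius (δ := 1 / (2 * B)) hp (by positivity)
  have h2p : (0 : ℝ) < 2 ^ p := by positivity
  have hnp : (0 : ℝ) < ((n : ℝ) + 1) ^ p := by positivity
  -- On the ball of radius `n r` about `z`, `‖w‖^p ≤ 2^p (‖z‖^p + (n + 1)^p r^p)`. The two entries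
  -- of the minimum bound the `z` part by `σ / 2` and the `r` part by `c`, uniformly in `α`; `n + 1`
  -- avoids a zero denominator for `n = 0`.
  have hτ : 0 < min (σ / 2 / 2 ^ p) (c / (2 ^ p * ((n : ℝ) + 1) ^ p)) := by positivity
  refine ⟨⟨_, hτ⟩, B * Real.exp 1, by positivity, fun f α z => ?_⟩
  have hτ1 := min_le_left (σ / 2 / 2 ^ p) (c / (2 ^ p * ((n : ℝ) + 1) ^ p))
  have hτ2 := min_le_right (σ / 2 / 2 ^ p) (c / (2 ^ p * ((n : ℝ) + 1) ^ p))
  have hfb := fun w => MinSpace.norm_apply_le ⟨_, hτ⟩ f w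
  have hN := MinSpace.nrm_nonneg ⟨_, hτ⟩ f
  simp only at hfb
  generalize MinSpace.nrm _ f = N at *
  generalize min (σ / 2 / 2 ^ p) (c / (2 ^ p * ((n : ℝ) + 1) ^ p)) = τ at *
  rw [le_div_iff₀ h2p] at hτ1
  rw [le_div_iff₀ (by positivity)] at hτ2
  obtain ⟨r, hr0, hr⟩ := hr α.length
  have hD := norm_multiDeriv_le f.differentiable α hr0 z
    (M := N * (Real.exp (σ / 2 * ‖z‖ ^ p) * Real.exp (c * r ^ p))) fun w hw => ?_
  · have hf : (0 : ℝ) < α.fact := by exact_mod_cast α.fact_pos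
    have hw := rootWeight_pos p α.length
    have h1 := hPB α z
    rw [← rootWeight] at h1
    rw [term, norm_mul]
    refine (mul_le_mul h1 hD (norm_nonneg _) (by positivity)).trans ?_
    have e1 : Real.exp (σ * ‖z‖ ^ p)
        = Real.exp (σ / 2 * ‖z‖ ^ p) * Real.exp (σ / 2 * ‖z‖ ^ p) := by
      rw [← Real.exp_add]; congr 1; ring
    have e2 : (1 / (2 * B) * r) ^ α.length = (1 / 2) ^ α.length * r ^ α.length / B ^ α.length := by
      rw [← mul_pow, ← div_pow]; congr 1; field_simp
    rw [e2] at hr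
    calc _ = B ^ (α.length + 1) * N * Real.exp (σ * ‖z‖ ^ p) / r ^ α.length *
          (Real.exp (c * r ^ p) * rootWeight p α.length) := by
          rw [e1]; field_simp
      _ ≤ B ^ (α.length + 1) * N * Real.exp (σ * ‖z‖ ^ p) / r ^ α.length *
          (Real.exp 1 * ((1 / 2) ^ α.length * r ^ α.length / B ^ α.length)) := by gcongr
      _ = _ := by
          rw [pow_succ]; field_simp
  · refine (hfb w).trans ?_
    rw [← Real.exp_add]
    have h1 : ‖w‖ ≤ ‖z‖ + (n + 1) * r := by
      have := norm_le_norm_add_norm_sub' w z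
      nlinarith
    have h2 : ‖w‖ ^ p ≤ 2 ^ p * (‖z‖ ^ p + ((n + 1) * r) ^ p) :=
      (Real.rpow_le_rpow (norm_nonneg _) h1 hp.le).trans
        (add_rpow_le_two_rpow_mul hp (norm_nonneg _) (by positivity))
    rw [Real.mul_rpow (by positivity) hr0.le] at h2
    have h3 : τ * ‖w‖ ^ p ≤ σ / 2 * ‖z‖ ^ p + c * r ^ p := by
      calc τ * ‖w‖ ^ p ≤ τ * (2 ^ p * (‖z‖ ^ p + ((n : ℝ) + 1) ^ p * r ^ p)) := by gcongr
        _ = τ * 2 ^ p * ‖z‖ ^ p + τ * (2 ^ p * ((n : ℝ) + 1) ^ p) * r ^ p := by ring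
        _ ≤ _ := by gcongr
    gcongr

theorem summable_half_pow_length (n : ℕ) :
    Summable fun α : MultiIndex n => (1 / 2 : ℝ) ^ α.length :=
  summable_pow_length n (by norm_num) (by norm_num)

theorem CondII.summable_term (hp : 0 < p) (h : P.CondII p) (f : MinSpace n p) (z : CSpace n) :
    Summable fun α => P.term f α z := by
  obtain ⟨τ, C, -, hC⟩ := h.exists_norm_term_le hp one_pos
  exact .of_norm_bounded ((summable_half_pow_length n).mul_right _) fun α => hC f α z

theorem CondII.term_mem (hp : 0 < p) (h : P.CondII p) (f : MinSpace n p) (α : MultiIndex n) :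
    P.term f α ∈ minSubmodule n p := by
  refine mem_minSubmodule (P.differentiable_term f.differentiable α) fun σ hσ => ?_
  obtain ⟨τ, C, -, hC⟩ := h.exists_norm_term_le hp hσ
  exact ⟨(1 / 2) ^ α.length * (C * MinSpace.nrm τ f), fun z => by
    rw [mul_assoc]; exact hC f α z⟩

/-- The remainder is controlled for an arbitrary finite set `s`, since unconditional convergence is
a limit along all finite sets. The case `s = ∅` bounds the operator itself. -/
theorem CondII.exists_norm_apply_sub_le (hp : 0 < p) (h : P.CondII p) {σ : ℝ} (hσ : 0 < σ) :
    ∃ (τ : Set.Ioi (0 : ℝ)) (C : ℝ), 0 ≤ C ∧ ∀ (f : MinSpace n p) (s : Finset (MultiIndex n))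
      (z : CSpace n), ‖P.apply f z - ∑ α ∈ s, P.term f α z‖ ≤
        (∑' α : {α // α ∉ s}, (1 / 2 : ℝ) ^ MultiIndex.length α.1) *
          (C * MinSpace.nrm τ f * Real.exp (σ * ‖z‖ ^ p)) := by
  obtain ⟨τ, C, hC0, hC⟩ := h.exists_norm_term_le hp hσ
  refine ⟨τ, C, hC0, fun f s z => ?_⟩
  rw [apply, ← (h.summable_term hp f z).sum_add_tsum_subtype_compl s, add_sub_cancel_left,
    ← tsum_mul_right]
  exact tsum_of_norm_bounded
    (((summable_half_pow_length n).subtype _).mul_right _).hasSum fun α => hC f α.1 z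

theorem CondII.exists_norm_apply_le (hp : 0 < p) (h : P.CondII p) {σ : ℝ} (hσ : 0 < σ) :
    ∃ (τ : Set.Ioi (0 : ℝ)) (C : ℝ), 0 ≤ C ∧ ∀ (f : MinSpace n p) (z : CSpace n),
      ‖P.apply f z‖ ≤ C * MinSpace.nrm τ f * Real.exp (σ * ‖z‖ ^ p) := by
  obtain ⟨τ, C, hC0, hC⟩ := h.exists_norm_apply_sub_le hp hσ
  refine ⟨τ, (∑' α : {α : MultiIndex n // α ∉ (∅ : Finset _)},
    (1 / 2 : ℝ) ^ MultiIndex.length α.1) * C,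
    mul_nonneg (tsum_nonneg fun _ => by positivity) hC0, fun f z => ?_⟩
  have := hC f ∅ z
  rwa [Finset.sum_empty, sub_zero, ← mul_assoc, ← mul_assoc] at this

theorem CondII.apply_mem (hp : 0 < p) (h : P.CondII p) (f : MinSpace n p) :
    P.apply f ∈ minSubmodule n p := by
  refine mem_minSubmodule ?_ fun σ hσ => ?_
  · obtain ⟨τ, C, hC0, hC⟩ := h.exists_norm_term_le hp one_pos
    have hN := MinSpace.nrm_nonneg τ f
    refine differentiable_tsum_of_norm_le (summable_half_pow_length n)
      (fun α => P.differentiable_term f.differentiable α)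
      (fun R => C * MinSpace.nrm τ f * Real.exp (1 * R ^ p)) fun R α w hw => (hC f α w).trans ?_
    gcongr
  · obtain ⟨τ, C, -, hC⟩ := h.exists_norm_apply_le hp hσ
    exact ⟨C * MinSpace.nrm τ f, hC f⟩

theorem CondII.hasSum_term (hp : 0 < p) (h : P.CondII p) (f : MinSpace n p) :
    HasSum (fun α => MinSpace.mk (P.term f α) (h.term_mem hp f α))
      (MinSpace.mk (P.apply f) (h.apply_mem hp f)) := by
  refine MinSpace.tendsto_nhds_iff.2 fun σ => ?_
  obtain ⟨τ, C, hC0, hC⟩ := h.exists_norm_apply_sub_le hp (Set.mem_Ioi.1 σ.2)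
  have hN := MinSpace.nrm_nonneg τ f
  have h1 := (tendsto_tsum_compl_atTop_zero
    fun α : MultiIndex n => (1 / 2 : ℝ) ^ α.length).mul_const (C * MinSpace.nrm τ f)
  rw [zero_mul] at h1
  refine squeeze_zero (fun _ => MinSpace.nrm_nonneg _ _) (fun s => ?_) h1
  refine (MinSpace.nrm_le_iff
    (mul_nonneg (tsum_nonneg fun _ => by positivity) (by positivity))).2 fun z => ?_
  have h2 : (∑ α ∈ s, MinSpace.mk (P.term f α) (h.term_mem hp f α)
      - MinSpace.mk (P.apply f) (h.apply_mem hp f) : MinSpace n p) z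
      = ∑ α ∈ s, P.term f α z - P.apply f z := by
    exact congrArg (· - P.apply f z)
      (MinSpace.sum_apply s (fun α => MinSpace.mk (P.term f α) (h.term_mem hp f α)) z)
  rw [h2, norm_sub_rev, mul_assoc]
  exact hC f s z

end FormalOp

/-! ### Linearity of the derivatives and the operator defined by `P` -/

section Linearity

variable {n : ℕ} {f g : CSpace n → ℂ}

theorem partialDeriv_add (hf : Differentiable ℂ f) (hg : Differentiable ℂ g) (j : Fin n) :
    partialDeriv j (f + g) = partialDeriv j f + partialDeriv j g := by
  funext z
  simp [partialDeriv, fderiv_add (hf z) (hg z)]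

theorem partialDeriv_smul (hf : Differentiable ℂ f) (c : ℂ) (j : Fin n) :
    partialDeriv j (c • f) = c • partialDeriv j f := by
  funext z
  simp [partialDeriv, fderiv_const_smul (hf z) c]

theorem partialDeriv_iterate_add (hf : Differentiable ℂ f) (hg : Differentiable ℂ g) (j : Fin n)
    (k : ℕ) : (partialDeriv j)^[k] (f + g) = (partialDeriv j)^[k] f + (partialDeriv j)^[k] g := by
  induction k with
  | zero => rfl
  | succ k ih =>
    rw [Function.iterate_succ_apply', ih, partialDeriv_add
      (differentiable_partialDeriv_iterate hf j k) (differentiable_partialDeriv_iterate hg j k),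
      Function.iterate_succ_apply', Function.iterate_succ_apply']

theorem partialDeriv_iterate_smul (hf : Differentiable ℂ f) (c : ℂ) (j : Fin n) (k : ℕ) :
    (partialDeriv j)^[k] (c • f) = c • (partialDeriv j)^[k] f := by
  induction k with
  | zero => rfl
  | succ k ih =>
    rw [Function.iterate_succ_apply', ih, partialDeriv_smul
      (differentiable_partialDeriv_iterate hf j k), Function.iterate_succ_apply']

theorem multiDeriv_add (hf : Differentiable ℂ f) (hg : Differentiable ℂ g) (α : MultiIndex n) :
    multiDeriv α (f + g) = multiDeriv α f + multiDeriv α g := by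
  unfold multiDeriv
  induction List.finRange n with
  | nil => rfl
  | cons j l ih =>
    rw [List.foldr_cons, ih, partialDeriv_iterate_add (differentiable_foldr hf α l)
      (differentiable_foldr hg α l), List.foldr_cons, List.foldr_cons]

theorem multiDeriv_smul (hf : Differentiable ℂ f) (c : ℂ) (α : MultiIndex n) :
    multiDeriv α (c • f) = c • multiDeriv α f := by
  unfold multiDeriv
  induction List.finRange n with
  | nil => rfl
  | cons j l ih =>
    rw [List.foldr_cons, ih, partialDeriv_iterate_smul (differentiable_foldr hf α l),
      List.foldr_cons]

end Linearity

namespace FormalOp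

variable {n : ℕ} {p : ℝ} {P : FormalOp n}

/-- The linear operator on `A_{p,0}` defined by `P`. -/
def CondII.toLin (hp : 0 < p) (h : P.CondII p) : MinSpace n p →ₗ[ℂ] MinSpace n p where
  toFun f := MinSpace.mk (P.apply f) (h.apply_mem hp f)
  map_add' f g := by
    refine Subtype.ext (funext fun z => ?_)
    change ∑' α, P.coeff α z * multiDeriv α (f.1 + g.1) z
      = (∑' α, P.term f.1 α z) + ∑' α, P.term g.1 α z
    rw [← (h.summable_term hp f z).tsum_add (h.summable_term hp g z)]
    refine tsum_congr fun α => ?_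
    rw [multiDeriv_add f.differentiable g.differentiable, Pi.add_apply, mul_add, term, term]
  map_smul' c f := by
    refine Subtype.ext (funext fun z => ?_)
    change ∑' α, P.coeff α z * multiDeriv α (c • f.1) z = c * ∑' α, P.term f.1 α z
    rw [← tsum_mul_left]
    refine tsum_congr fun α => ?_
    rw [multiDeriv_smul f.differentiable, Pi.smul_apply, smul_eq_mul, term, mul_left_comm]

/-- The continuous linear operator on `A_{p,0}` defined by `P`. -/
def CondII.toCLM (hp : 0 < p) (h : P.CondII p) : MinSpace n p →L[ℂ] MinSpace n p where
  toLinearMap := h.toLin hp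
  cont := by
    refine MinSpace.continuous_of_nrm_le (h.toLin hp) fun σ => ?_
    obtain ⟨τ, C, hC0, hC⟩ := h.exists_norm_apply_le hp (Set.mem_Ioi.1 σ.2)
    exact ⟨τ, C, fun f => (MinSpace.nrm_le_iff (mul_nonneg hC0 (MinSpace.nrm_nonneg τ f))).2 (hC f)⟩

end FormalOp

/-! ### Shifted monomials -/

/-- The monomial `(w - z) ^ β` in `w`. -/
def shiftedMonomial {n : ℕ} (z : CSpace n) (β : MultiIndex n) (w : CSpace n) : ℂ :=
  ∏ j, (w j - z j) ^ β j

section Product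

variable {n : ℕ}

/-- Differentiation keeps products of one-variable functions in product form and changes a single
factor, so the computation can be iterated. -/
theorem partialDeriv_prod (g : Fin n → ℂ → ℂ) (hg : ∀ i, Differentiable ℂ (g i)) (j : Fin n) :
    partialDeriv j (fun w : CSpace n => ∏ i, g i (w i)) =
      fun w => ∏ i, Function.update g j (deriv (g j)) i (w i) := by
  funext w
  have hd : ∀ u : CSpace n → ℂ, Differentiable ℂ u →
      partialDeriv j u w = deriv (fun t : ℂ => u (w + t • EuclideanSpace.single j 1)) 0 := by
    intro u hu
    rw [deriv_line hu, zero_smul, add_zero, partialDeriv]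
  rw [hd _ (by fun_prop)]
  have e : (fun t : ℂ => ∏ i, g i ((w + t • (EuclideanSpace.single j 1 : CSpace n)) i)) =
      fun t => g j (w j + t) * ∏ i ∈ Finset.univ.erase j, g i (w i) := by
    funext t
    rw [← Finset.mul_prod_erase _ _ (Finset.mem_univ j)]
    congr 1
    · simp
    · refine Finset.prod_congr rfl fun i hi => ?_
      simp [(Finset.mem_erase.1 hi).1]
  rw [e, deriv_mul_const_field, ← Finset.mul_prod_erase _ _ (Finset.mem_univ j),
    Function.update_self]
  congr 1
  · rw [deriv_comp_const_add, add_zero]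
  · refine Finset.prod_congr rfl fun i hi => ?_
    rw [Function.update_of_ne (Finset.mem_erase.1 hi).1]

theorem differentiable_iterate_deriv {g : ℂ → ℂ} (hg : Differentiable ℂ g) (k : ℕ) :
    Differentiable ℂ (deriv^[k] g) := by
  induction k with
  | zero => exact hg
  | succ k ih => rw [Function.iterate_succ_apply']; exact ih.deriv

theorem partialDeriv_iterate_prod (g : Fin n → ℂ → ℂ) (hg : ∀ i, Differentiable ℂ (g i))
    (j : Fin n) (k : ℕ) :
    (partialDeriv j)^[k] (fun w : CSpace n => ∏ i, g i (w i)) =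
      fun w => ∏ i, Function.update g j (deriv^[k] (g j)) i (w i) := by
  induction k with
  | zero => simp
  | succ k ih =>
    rw [Function.iterate_succ_apply', ih, partialDeriv_prod]
    · simp [Function.iterate_succ_apply']
    · intro i
      rcases eq_or_ne i j with rfl | h
      · rw [Function.update_self]; exact differentiable_iterate_deriv (hg i) k
      · rw [Function.update_of_ne h]; exact hg i

theorem foldr_prod (g : Fin n → ℂ → ℂ) (hg : ∀ i, Differentiable ℂ (g i)) (α : MultiIndex n)
    (l : List (Fin n)) (hl : l.Nodup) :
    l.foldr (fun j u => (partialDeriv j)^[α j] u) (fun w : CSpace n => ∏ i, g i (w i)) =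
      fun w => ∏ i, (if i ∈ l then deriv^[α i] (g i) else g i) (w i) := by
  induction l with
  | nil => simp
  | cons j l ih =>
    rw [List.foldr_cons, ih (List.nodup_cons.1 hl).2, partialDeriv_iterate_prod
      (fun i => if i ∈ l then deriv^[α i] (g i) else g i)]
    · funext w
      refine Finset.prod_congr rfl fun i _ => ?_
      rcases eq_or_ne i j with rfl | h
      · simp [(List.nodup_cons.1 hl).1]
      · simp [h]
    · intro i
      split_ifs
      · exact differentiable_iterate_deriv (hg i) _
      · exact hg i

theorem multiDeriv_prod (g : Fin n → ℂ → ℂ) (hg : ∀ i, Differentiable ℂ (g i))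
    (α : MultiIndex n) :
    multiDeriv α (fun w : CSpace n => ∏ i, g i (w i)) = fun w => ∏ i, deriv^[α i] (g i) (w i) := by
  rw [multiDeriv, foldr_prod g hg α _ (List.nodup_finRange n)]
  simp

theorem iterate_deriv_sub_pow (a b : ℕ) (c : ℂ) :
    deriv^[a] (fun t : ℂ => (t - c) ^ b) c = if a = b then (b.factorial : ℂ) else 0 := by
  rw [← iteratedDeriv_eq_iterate, iteratedDeriv_comp_sub_const a (fun t : ℂ => t ^ b) c]
  simp only [sub_self, iteratedDeriv_fun_pow_zero, Nat.cast_ite, Nat.cast_zero]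

/-- The derivative factors over the coordinates, and a factor vanishes at the centre as soon as the
two exponents differ in that coordinate. -/
theorem multiDeriv_shiftedMonomial (z : CSpace n) (α β : MultiIndex n) :
    multiDeriv α (shiftedMonomial z β) z = if α = β then (β.fact : ℂ) else 0 := by
  have h := congrFun (multiDeriv_prod (fun i t => (t - z i) ^ β i) (fun i => by fun_prop) α) z
  simp only [iterate_deriv_sub_pow] at h
  refine h.trans ?_
  split_ifs with hαβ
  · subst hαβ; simp [MultiIndex.fact]
  · obtain ⟨i, hi⟩ := Function.ne_iff.1 hαβ
    exact Finset.prod_eq_zero (Finset.mem_univ i) (if_neg hi)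

/-- Binomial expansion of a shifted monomial about another centre. -/
theorem shiftedMonomial_expand (z z' : CSpace n) (β : MultiIndex n) (w : CSpace n) :
    shiftedMonomial z β w = ∑ γ ∈ Fintype.piFinset fun j => Finset.range (β j + 1),
      (∏ j, ((z' j - z j) ^ (β j - γ j) * ((β j).choose (γ j) : ℂ))) * shiftedMonomial z' γ w := by
  simp only [shiftedMonomial, ← Finset.prod_mul_distrib]
  rw [← Finset.prod_univ_sum (fun j => Finset.range (β j + 1)) fun j k =>
    (z' j - z j) ^ (β j - k) * ((β j).choose k : ℂ) * (w j - z' j) ^ k]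
  refine Finset.prod_congr rfl fun j _ => ?_
  rw [show w j - z j = (w j - z' j) + (z' j - z j) by ring, add_pow]
  exact Finset.sum_congr rfl fun k _ => by ring

theorem norm_shiftedMonomial_le (z : CSpace n) (β : MultiIndex n) (w : CSpace n) :
    ‖shiftedMonomial z β w‖ ≤ ‖w - z‖ ^ β.length := by
  rw [shiftedMonomial, norm_prod, MultiIndex.length, ← Finset.prod_pow_eq_pow_sum]
  refine Finset.prod_le_prod (fun _ _ => norm_nonneg _) fun j _ => ?_
  rw [norm_pow]
  exact pow_le_pow_left₀ (norm_nonneg _) (PiLp.norm_apply_le (w - z) j) _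

theorem differentiable_shiftedMonomial (z : CSpace n) (β : MultiIndex n) :
    Differentiable ℂ (shiftedMonomial z β) := by
  unfold shiftedMonomial
  fun_prop

/-- The growth of `‖w - z‖^{|β|}` is separated into a factor in `z` and a factor in `w`, with `K`
independent of both and of `β`. For the symbol, the first factor feeds the growth of the
coefficient, the second the norm of the monomial. -/
theorem exists_norm_shiftedMonomial_le {p τ : ℝ} (hp : 0 < p) (hτ : 0 < τ) :
    ∃ K : ℝ, 0 < K ∧ ∀ (z : CSpace n) (β : MultiIndex n) (w : CSpace n),
      ‖shiftedMonomial z β w‖ ≤ K ^ β.length * rootWeight p β.length *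
        Real.exp (τ * ‖z‖ ^ p) * Real.exp (τ * ‖w‖ ^ p) := by
  have h2p : (0 : ℝ) < 2 ^ p := by positivity
  obtain ⟨K, hK, h⟩ := exists_pow_le_exp hp (c := τ / 2 ^ p) (by positivity)
  refine ⟨K, hK, fun z β w => (norm_shiftedMonomial_le z β w).trans ?_⟩
  refine (h β.length ‖w - z‖ (norm_nonneg _)).trans ?_
  have hw := rootWeight_pos p β.length
  rw [mul_assoc (K ^ _ * _), ← Real.exp_add]
  have h1 : ‖w - z‖ ^ p ≤ 2 ^ p * (‖w‖ ^ p + ‖z‖ ^ p) :=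
    (Real.rpow_le_rpow (norm_nonneg _) (norm_sub_le _ _) hp.le).trans
      (add_rpow_le_two_rpow_mul hp (norm_nonneg _) (norm_nonneg _))
  have h3 : τ / 2 ^ p * ‖w - z‖ ^ p ≤ τ * ‖z‖ ^ p + τ * ‖w‖ ^ p := by
    calc τ / 2 ^ p * ‖w - z‖ ^ p ≤ τ / 2 ^ p * (2 ^ p * (‖w‖ ^ p + ‖z‖ ^ p)) := by gcongr
      _ = _ := by field_simp; ring
  gcongr

theorem shiftedMonomial_mem {p : ℝ} (hp : 0 < p) (z : CSpace n) (β : MultiIndex n) :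
    shiftedMonomial z β ∈ minSubmodule n p := by
  refine mem_minSubmodule (differentiable_shiftedMonomial z β) fun τ hτ => ?_
  obtain ⟨K, -, h⟩ := exists_norm_shiftedMonomial_le (n := n) hp hτ
  exact ⟨_, h z β⟩

end Product

/-! ### Density of the polynomials -/

section Taylor

variable {n : ℕ} {f : CSpace n → ℂ}

theorem fderiv_eq_sum (f : CSpace n → ℂ) (w v : CSpace n) :
    fderiv ℂ f w v = ∑ j, v j * partialDeriv j f w := by
  conv_lhs => rw [← (EuclideanSpace.basisFun (Fin n) ℂ).sum_repr v]
  simp [partialDeriv]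

theorem differentiable_ray (hf : Differentiable ℂ f) (z : CSpace n) :
    Differentiable ℂ fun t : ℂ => f (t • z) := by
  simpa using differentiable_line hf 0 z

theorem deriv_ray (hf : Differentiable ℂ f) (z : CSpace n) :
    deriv (fun t : ℂ => f (t • z)) = fun t => ∑ j, z j * partialDeriv j f (t • z) := by
  funext t
  have h := deriv_line hf 0 z t
  simp only [zero_add] at h
  rw [h, fderiv_eq_sum]

/-- The homogeneous part of degree `k` of the Taylor expansion of `f` at the origin. -/
def homogeneousPart (f : CSpace n → ℂ) (k : ℕ) (z : CSpace n) : ℂ :=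
  (k.factorial : ℂ)⁻¹ * iteratedDeriv k (fun t : ℂ => f (t • z)) 0

theorem hasSum_homogeneousPart (hf : Differentiable ℂ f) (z : CSpace n) :
    HasSum (fun k => homogeneousPart f k z) (f z) := by
  have h := Complex.hasSum_taylorSeries_of_entire (differentiable_ray hf z) 0 1
  simpa [homogeneousPart] using h

/-- The space of polynomial functions. -/
def polynomials (n : ℕ) : Submodule ℂ (CSpace n → ℂ) :=
  Submodule.span ℂ (Set.range (shiftedMonomial 0))

theorem coord_mul_mem_polynomials (j : Fin n) {g : CSpace n → ℂ} (hg : g ∈ polynomials n) :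
    (fun z => z j * g z) ∈ polynomials n := by
  induction hg using Submodule.span_induction with
  | mem g hg =>
    obtain ⟨β, rfl⟩ := hg
    refine Submodule.subset_span ⟨Function.update β j (β j + 1), funext fun z => ?_⟩
    simp only [shiftedMonomial, PiLp.zero_apply, sub_zero]
    rw [← Finset.mul_prod_erase _ _ (Finset.mem_univ j),
      ← Finset.mul_prod_erase _ (fun i => z i ^ β i) (Finset.mem_univ j), Function.update_self,
      pow_succ', mul_assoc]
    congr 2
    refine Finset.prod_congr rfl fun i hi => ?_
    rw [Function.update_of_ne (Finset.mem_erase.1 hi).1]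
  | zero =>
    simp only [Pi.zero_apply, mul_zero]
    exact (polynomials n).zero_mem
  | add g h _ _ hg hh =>
    convert (polynomials n).add_mem hg hh using 1
    funext z
    simp [mul_add]
  | smul c g _ hg =>
    convert (polynomials n).smul_mem c hg using 1
    funext z
    simp [mul_left_comm]

/-- The derivative of `f (t z)` in `t` is `∑ z_j (∂_j f)(t z)`; the induction therefore runs over
all entire `f` at once, and each step multiplies by a coordinate. -/
theorem iteratedDeriv_ray_mem_polynomials (k : ℕ) (hf : Differentiable ℂ f) :
    (fun z => iteratedDeriv k (fun t : ℂ => f (t • z)) 0) ∈ polynomials n := by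
  induction k generalizing f with
  | zero =>
    have h := (polynomials n).smul_mem (f 0)
      (Submodule.subset_span ⟨0, rfl⟩ : shiftedMonomial 0 0 ∈ polynomials n)
    convert h using 1
    funext z
    simp [shiftedMonomial]
  | succ k ih =>
    have e : (fun z => iteratedDeriv (k + 1) (fun t : ℂ => f (t • z)) 0) = ∑ j, fun z =>
        z j * iteratedDeriv k (fun t : ℂ => partialDeriv j f (t • z)) 0 := by
      funext z
      have hd : ∀ j, ContDiff ℂ k fun t : ℂ => partialDeriv j f (t • z) := fun j =>
        (differentiable_ray (differentiable_partialDeriv hf j) z).contDiff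
      rw [iteratedDeriv_succ', deriv_ray hf,
        iteratedDeriv_fun_sum fun j _ => (contDiff_const.mul (hd j)).contDiffAt, Finset.sum_apply]
      exact Finset.sum_congr rfl fun j _ => iteratedDeriv_const_mul_field _ _
    rw [e]
    exact Submodule.sum_mem _ fun j _ =>
      coord_mul_mem_polynomials j (ih (differentiable_partialDeriv hf j))

theorem homogeneousPart_mem_polynomials (hf : Differentiable ℂ f) (k : ℕ) :
    homogeneousPart f k ∈ polynomials n :=
  (polynomials n).smul_mem _ (iteratedDeriv_ray_mem_polynomials k hf)

theorem norm_homogeneousPart_le (hf : Differentiable ℂ f) (k : ℕ) (z : CSpace n) {ρ M : ℝ}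
    (hρ : 0 < ρ) (hM : ∀ w, ‖w‖ ≤ ρ * ‖z‖ → ‖f w‖ ≤ M) :
    ‖homogeneousPart f k z‖ ≤ M / ρ ^ k := by
  have h := Complex.norm_iteratedDeriv_le_of_forall_mem_sphere_norm_le (c := 0) (C := M) k hρ
    (differentiable_ray hf z).diffContOnCl fun t ht => hM _ ?_
  · have hk : (0 : ℝ) < k.factorial := by positivity
    rw [homogeneousPart, norm_mul, norm_inv, Complex.norm_natCast, inv_mul_le_iff₀ hk]
    refine h.trans (le_of_eq (by ring))
  · rw [mem_sphere_zero_iff_norm] at ht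
    rw [norm_smul, ht]

/-- Cauchy on the ray gives `M(r) (‖z‖ / r)^k`, where `M(r)` bounds `f` on the ball of radius `r`.
Bounding `‖z‖^k` costs `K^k k^{k/p}`, which the radius for `δ = 1 / (2K)` repays with a factor
`2^{-k}` to spare. -/
theorem exists_norm_homogeneousPart_le {p σ : ℝ} (hp : 0 < p) (hσ : 0 < σ) :
    ∃ τ : Set.Ioi (0 : ℝ), ∀ (f : MinSpace n p) (k : ℕ) (z : CSpace n),
      ‖homogeneousPart f k z‖ ≤
        (1 / 2) ^ k * (Real.exp 1 * MinSpace.nrm τ f * Real.exp (σ * ‖z‖ ^ p)) := by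
  obtain ⟨K, hK, hKb⟩ := exists_pow_le_exp hp hσ
  obtain ⟨c, hc, hr⟩ := exists_radius (δ := 1 / (2 * K)) hp (by positivity)
  refine ⟨⟨c, hc⟩, fun f k z => ?_⟩
  have hN := MinSpace.nrm_nonneg ⟨c, hc⟩ f
  have hfb := fun w => MinSpace.norm_apply_le ⟨c, hc⟩ f w
  simp only at hfb
  generalize MinSpace.nrm _ f = N at *
  obtain ⟨r, hr0, hr⟩ := hr k
  have hw := rootWeight_pos p k
  have he : (1 : ℝ) ≤ Real.exp 1 := Real.one_le_exp zero_le_one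
  -- The parameter radius `r / ‖z‖` makes no sense at the origin; there only the part of degree `0`
  -- survives.
  rcases eq_or_ne z 0 with rfl | hz
  · have h0 : ‖homogeneousPart f k 0‖ ≤ (1 / 2) ^ k * ‖f 0‖ := by
      rcases Nat.eq_zero_or_pos k with rfl | hk
      · simp [homogeneousPart]
      · simp only [homogeneousPart, smul_zero, iteratedDeriv_const, hk.ne', if_false, mul_zero,
          norm_zero]
        positivity
    refine h0.trans ?_
    gcongr
    refine (hfb 0).trans ?_
    rw [norm_zero, Real.zero_rpow hp.ne', mul_zero, mul_zero]
    gcongr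
    nlinarith
  · have hz' : 0 < ‖z‖ := norm_pos_iff.2 hz
    have h := norm_homogeneousPart_le f.differentiable k z (ρ := r / ‖z‖)
      (M := N * Real.exp (c * r ^ p)) (by positivity) fun w hw => (hfb w).trans ?_
    · refine h.trans ?_
      have h1 := hKb k ‖z‖ hz'.le
      have e2 : (1 / (2 * K) * r) ^ k = (1 / 2) ^ k * r ^ k / K ^ k := by
        rw [← mul_pow, ← div_pow]; congr 1; field_simp
      rw [e2] at hr
      calc N * Real.exp (c * r ^ p) / (r / ‖z‖) ^ k
          = N * Real.exp (c * r ^ p) / r ^ k * ‖z‖ ^ k := by rw [div_pow]; field_simp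
        _ ≤ N * Real.exp (c * r ^ p) / r ^ k *
            (K ^ k * rootWeight p k * Real.exp (σ * ‖z‖ ^ p)) := by gcongr
        _ = N * K ^ k / r ^ k * Real.exp (σ * ‖z‖ ^ p) *
            (Real.exp (c * r ^ p) * rootWeight p k) := by ring
        _ ≤ N * K ^ k / r ^ k * Real.exp (σ * ‖z‖ ^ p) *
            (Real.exp 1 * ((1 / 2) ^ k * r ^ k / K ^ k)) := by gcongr
        _ = _ := by field_simp
    · rw [div_mul_cancel₀ _ hz'.ne'] at hw
      gcongr

end Taylor

namespace MinSpace

variable {n : ℕ} {p : ℝ}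

/-- A shifted monomial as an element of `A_{p,0}`. -/
def monomial (hp : 0 < p) (z : CSpace n) (β : MultiIndex n) : MinSpace n p :=
  mk (shiftedMonomial z β) (shiftedMonomial_mem hp z β)

/-- The inclusion of `A_{p,0}` into the space of all functions. -/
def coeLin (n : ℕ) (p : ℝ) : MinSpace n p →ₗ[ℂ] (CSpace n → ℂ) := (minSubmodule n p).subtype

theorem polynomials_le_map (S : Submodule ℂ (MinSpace n p)) (hp : 0 < p)
    (hS : ∀ β, monomial hp 0 β ∈ S) : polynomials n ≤ S.map (coeLin n p) := by
  refine Submodule.span_le.2 ?_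
  rintro _ ⟨β, rfl⟩
  exact ⟨_, hS β, rfl⟩

/-- Transfers a span taken among all functions to a subspace of `A_{p,0}`, where the kernel of a
functional lives. -/
theorem mk_mem_of_mem_polynomials (S : Submodule ℂ (MinSpace n p)) (hp : 0 < p)
    (hS : ∀ β, monomial hp 0 β ∈ S) {f : MinSpace n p} (hf : f.1 ∈ polynomials n) : f ∈ S := by
  obtain ⟨g, hg, e⟩ := polynomials_le_map S hp hS hf
  rwa [show f = g from Subtype.ext e.symm]

theorem homogeneousPart_mem (hp : 0 < p) (f : MinSpace n p) (k : ℕ) :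
    homogeneousPart f k ∈ minSubmodule n p := by
  obtain ⟨g, -, e⟩ := polynomials_le_map ⊤ hp (fun _ => Submodule.mem_top)
    (homogeneousPart_mem_polynomials f.differentiable k)
  rw [← e]
  exact g.2

theorem tendsto_sum_homogeneousPart (hp : 0 < p) (f : MinSpace n p) (σ : Set.Ioi (0 : ℝ)) :
    Filter.Tendsto (fun N => nrm σ (f - ∑ k ∈ Finset.range N,
      mk (homogeneousPart f k) (homogeneousPart_mem hp f k))) Filter.atTop (nhds 0) := by
  obtain ⟨τ, hτ⟩ := exists_norm_homogeneousPart_le (n := n) hp (Set.mem_Ioi.1 σ.2)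
  have hN := nrm_nonneg τ f
  have h1 := (tendsto_sum_nat_add fun k => (1 / 2 : ℝ) ^ k).mul_const (Real.exp 1 * nrm τ f)
  rw [zero_mul] at h1
  refine squeeze_zero (fun _ => nrm_nonneg _ _) (fun N => ?_) h1
  refine (nrm_le_iff
    (mul_nonneg (tsum_nonneg fun _ => by positivity) (by positivity))).2 fun z => ?_
  have h2 : (f - ∑ k ∈ Finset.range N,
      mk (homogeneousPart f k) (homogeneousPart_mem hp f k) : MinSpace n p) z
      = f z - ∑ k ∈ Finset.range N, homogeneousPart f k z :=
    congrArg (f z - ·) (sum_apply _ (fun k =>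
      mk (homogeneousPart f k) (homogeneousPart_mem hp f k)) z)
  have h3 := hasSum_homogeneousPart f.differentiable z
  rw [h2, ← h3.tsum_eq, ← h3.summable.sum_add_tsum_nat_add N, add_sub_cancel_left, mul_assoc,
    ← tsum_mul_right]
  exact tsum_of_norm_bounded
    (((summable_nat_add_iff N).2 summable_geometric_two).mul_right _).hasSum fun k => hτ f _ z

/-- A bounded linear functional on `A_{p,0}` that vanishes on monomials is zero. -/
theorem eq_zero_of_monomial (hp : 0 < p) (L : MinSpace n p →ₗ[ℂ] ℂ) {τ : Set.Ioi (0 : ℝ)} {C : ℝ}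
    (hL : ∀ f, ‖L f‖ ≤ C * nrm τ f) (h : ∀ β, L (monomial hp 0 β) = 0) (f : MinSpace n p) :
    L f = 0 := by
  have h1 := (tendsto_sum_homogeneousPart hp f τ).const_mul C
  rw [mul_zero] at h1
  refine norm_le_zero_iff.1 (ge_of_tendsto' h1 fun N => ?_)
  have h2 : L (∑ k ∈ Finset.range N,
      mk (homogeneousPart f k) (homogeneousPart_mem hp f k)) = 0 := by
    rw [map_sum]
    refine Finset.sum_eq_zero fun k _ => LinearMap.mem_ker.1 ?_
    exact mk_mem_of_mem_polynomials (LinearMap.ker L) hp h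
      (homogeneousPart_mem_polynomials f.differentiable k)
  have h3 := hL (f - ∑ k ∈ Finset.range N,
      mk (homogeneousPart f k) (homogeneousPart_mem hp f k))
  rwa [map_sub, h2, sub_zero] at h3

theorem monomial_expand (hp : 0 < p) (z z' : CSpace n) (β : MultiIndex n) :
    monomial hp z β = ∑ γ ∈ Fintype.piFinset fun j => Finset.range (β j + 1),
      (∏ j, ((z' j - z j) ^ (β j - γ j) * ((β j).choose (γ j) : ℂ))) • monomial hp z' γ := by
  refine Subtype.ext (funext fun w => ?_)
  rw [sum_apply]
  exact shiftedMonomial_expand z z' β w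

end MinSpace

/-! ### The symbol of a continuous linear operator -/

section Symbol

variable {n : ℕ} {p : ℝ}

/-- The formal differential operator representing a continuous linear operator. -/
def symbol (hp : 0 < p) (F : MinSpace n p →L[ℂ] MinSpace n p) : FormalOp n where
  coeff β z := (β.fact : ℂ)⁻¹ * F (MinSpace.monomial hp z β) z
  entire β := by
    refine Differentiable.const_mul ?_ _
    -- The variable `z` occurs both as centre and as evaluation point. Expanding about the fixed
    -- centre `0` separates the two: polynomials in `z` times the entire functions `F (w^γ)`.
    have e : (fun z => F (MinSpace.monomial hp z β) z) = fun z =>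
        ∑ γ ∈ Fintype.piFinset fun j => Finset.range (β j + 1),
          (∏ j, (((0 : CSpace n) j - z j) ^ (β j - γ j) * ((β j).choose (γ j) : ℂ))) *
            F (MinSpace.monomial hp 0 γ) z := by
      funext z
      rw [MinSpace.monomial_expand hp z 0 β, map_sum]
      simp only [map_smul]
      rw [MinSpace.sum_apply]
      rfl
    rw [e]
    refine Differentiable.fun_sum fun γ _ => Differentiable.mul (by fun_prop)
      (F (MinSpace.monomial hp 0 γ)).differentiable

theorem symbol_condII (hp : 0 < p) (F : MinSpace n p →L[ℂ] MinSpace n p) :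
    (symbol hp F).CondII p := by
  intro ε hε
  obtain ⟨τ, C, hC, hF⟩ := MinSpace.exists_nrm_le F ⟨ε / 2, Set.mem_Ioi.2 (by positivity)⟩
  have hτ : (0 : ℝ) < τ := τ.2
  -- One exponent must serve two bounds: at most `τ` in the variable of the monomial and at most `ε
  -- / 2` in its centre.
  have hc : 0 < min (τ : ℝ) (ε / 2) := by positivity
  obtain ⟨K, hK, hm⟩ := exists_norm_shiftedMonomial_le (n := n) hp hc
  refine ⟨max C K, lt_max_of_lt_left hC, fun α z => ?_⟩
  have hw := rootWeight_pos p α.length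
  have hf : (0 : ℝ) < α.fact := by exact_mod_cast α.fact_pos
  have h1 : MinSpace.nrm τ (MinSpace.monomial hp z α) ≤
      K ^ α.length * rootWeight p α.length * Real.exp (ε / 2 * ‖z‖ ^ p) := by
    refine (MinSpace.nrm_le_iff (by positivity)).2 fun w => (hm z α w).trans ?_
    have := min_le_left (τ : ℝ) (ε / 2)
    have := min_le_right (τ : ℝ) (ε / 2)
    gcongr
  have h2 := MinSpace.norm_apply_le ⟨ε / 2, Set.mem_Ioi.2 (by positivity)⟩
    (F (MinSpace.monomial hp z α)) z
  have e1 : Real.exp (ε * ‖z‖ ^ p)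
      = Real.exp (ε / 2 * ‖z‖ ^ p) * Real.exp (ε / 2 * ‖z‖ ^ p) := by
    rw [← Real.exp_add]; congr 1; ring
  rw [symbol, norm_mul, norm_inv, Complex.norm_natCast, ← rootWeight, e1]
  have h3 : C * K ^ α.length ≤ max C K ^ (α.length + 1) := by
    rw [pow_succ']
    gcongr
    · exact le_max_left _ _
    · exact le_max_right _ _
  calc (α.fact : ℝ)⁻¹ * ‖F (MinSpace.monomial hp z α) z‖
      ≤ (α.fact : ℝ)⁻¹ * (C * (K ^ α.length * rootWeight p α.length *
          Real.exp (ε / 2 * ‖z‖ ^ p)) * Real.exp (ε / 2 * ‖z‖ ^ p)) := by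
        refine mul_le_mul_of_nonneg_left (h2.trans ?_) (by positivity)
        exact mul_le_mul_of_nonneg_right ((hF _).trans (by gcongr)) (by positivity)
    _ = rootWeight p α.length / α.fact * (C * K ^ α.length) *
          (Real.exp (ε / 2 * ‖z‖ ^ p) * Real.exp (ε / 2 * ‖z‖ ^ p)) := by ring
    _ ≤ _ := by gcongr

theorem FormalOp.apply_shiftedMonomial (P : FormalOp n) (z : CSpace n) (β : MultiIndex n) :
    P.apply (shiftedMonomial z β) z = β.fact * P.coeff β z := by
  rw [apply, tsum_eq_single β, term, multiDeriv_shiftedMonomial, if_pos rfl, mul_comm]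
  intro α hα
  rw [term, multiDeriv_shiftedMonomial, if_neg hα, mul_zero]

theorem symbol_apply (hp : 0 < p) (F : MinSpace n p →L[ℂ] MinSpace n p) (f : MinSpace n p) :
    (F f : CSpace n → ℂ) = (symbol hp F).apply f := by
  have hP := symbol_condII hp F
  funext z
  -- Since the symbol satisfies (II), it defines a continuous operator; `L` is the difference of the
  -- two operators evaluated at `z`.
  let G : MinSpace n p →L[ℂ] MinSpace n p := hP.toCLM hp
  let L : MinSpace n p →ₗ[ℂ] ℂ :=
    (MinSpace.eval z).comp (F : MinSpace n p →ₗ[ℂ] MinSpace n p)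
      - (MinSpace.eval z).comp (G : MinSpace n p →ₗ[ℂ] MinSpace n p)
  have hLz : ∀ β, L (MinSpace.monomial hp z β) = 0 := by
    intro β
    have hf : (β.fact : ℂ) ≠ 0 := by exact_mod_cast β.fact_pos.ne'
    have h := (symbol hp F).apply_shiftedMonomial z β
    rw [symbol, mul_inv_cancel_left₀ hf] at h
    exact sub_eq_zero.2 h.symm
  -- The density argument uses monomials centred at `0`, which are finite combinations of those
  -- centred at `z`.
  have hL0 : ∀ β, L (MinSpace.monomial hp 0 β) = 0 := by
    intro β
    rw [MinSpace.monomial_expand hp 0 z β, map_sum]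
    exact Finset.sum_eq_zero fun γ _ => by rw [map_smul, hLz, smul_zero]
  let σ : Set.Ioi (0 : ℝ) := ⟨1, Set.mem_Ioi.2 one_pos⟩
  obtain ⟨τ₁, C₁, hC₁, h₁⟩ := MinSpace.exists_nrm_le F σ
  obtain ⟨τ₂, C₂, hC₂, h₂⟩ := MinSpace.exists_nrm_le G σ
  have hbound : ∀ g, ‖L g‖ ≤ ((C₁ + C₂) * Real.exp (σ * ‖z‖ ^ p)) * MinSpace.nrm (min τ₁ τ₂) g := by
    intro g
    have a₁ := (h₁ g).trans
      (mul_le_mul_of_nonneg_left (MinSpace.nrm_anti (min_le_left τ₁ τ₂) g) hC₁.le)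
    have a₂ := (h₂ g).trans
      (mul_le_mul_of_nonneg_left (MinSpace.nrm_anti (min_le_right τ₁ τ₂) g) hC₂.le)
    calc ‖L g‖ ≤ ‖F g z‖ + ‖G g z‖ := norm_sub_le _ _
      _ ≤ MinSpace.nrm σ (F g) * Real.exp (σ * ‖z‖ ^ p)
          + MinSpace.nrm σ (G g) * Real.exp (σ * ‖z‖ ^ p) :=
        add_le_add (MinSpace.norm_apply_le σ _ z) (MinSpace.norm_apply_le σ _ z)
      _ ≤ (C₁ * MinSpace.nrm (min τ₁ τ₂) g) * Real.exp (σ * ‖z‖ ^ p)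
          + (C₂ * MinSpace.nrm (min τ₁ τ₂) g) * Real.exp (σ * ‖z‖ ^ p) := by gcongr
      _ = _ := by ring
  exact sub_eq_zero.1 (MinSpace.eq_zero_of_monomial hp L hbound hL0 f)

/-- Testing on the monomial centred at `z` and evaluating at `z` isolates a single coefficient. -/
theorem eq_symbol (hp : 0 < p) (F : MinSpace n p →L[ℂ] MinSpace n p) (P : FormalOp n)
    (h : ∀ f : MinSpace n p, (F f : CSpace n → ℂ) = P.apply f) : P = symbol hp F := by
  refine FormalOp.ext (funext fun β => funext fun z => ?_)
  have hf : (β.fact : ℂ) ≠ 0 := by exact_mod_cast β.fact_pos.ne'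
  have h1 := congrFun (h (MinSpace.monomial hp z β)) z
  have h2 := P.apply_shiftedMonomial z β
  change P.coeff β z = (β.fact : ℂ)⁻¹ * F (MinSpace.monomial hp z β) z
  rw [h1]
  change P.coeff β z = (β.fact : ℂ)⁻¹ * P.apply (shiftedMonomial z β) z
  rw [h2, inv_mul_cancel_left₀ hf]

end Symbol

end EntireOp

end

theorem theorem2 (n : ℕ) (p : ℝ) (hp : 0 < p) :
    -- the four growth conditions defining `D_{p,0}` are equivalent
    (∀ P : EntireOp.FormalOp n, [P.CondI p, P.CondII p, P.CondIII p, P.CondIV p].TFAE) ∧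
    -- every `P ∈ D_{p,0}` acts on `A_{p,0}` as a continuous linear operator
    (∀ P ∈ EntireOp.DClass n p,
      (∀ f : EntireOp.MinSpace n p,
        (∀ z, Summable fun α => P.term f α z) ∧
        ∃ (hterm : ∀ α, P.term f α ∈ EntireOp.minSubmodule n p)
          (hsum : P.apply f ∈ EntireOp.minSubmodule n p),
          HasSum (fun α => EntireOp.MinSpace.mk (P.term f α) (hterm α))
            (EntireOp.MinSpace.mk (P.apply f) hsum)) ∧
      ∃ T : EntireOp.MinSpace n p →L[ℂ] EntireOp.MinSpace n p,
        ∀ f : EntireOp.MinSpace n p, (T f : EntireOp.CSpace n → ℂ) = P.apply f) ∧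
    -- every continuous linear operator is of this form for a unique `P ∈ D_{p,0}`
    (∀ F : EntireOp.MinSpace n p →L[ℂ] EntireOp.MinSpace n p,
      ∃! P : EntireOp.FormalOp n, P ∈ EntireOp.DClass n p ∧
        ∀ f : EntireOp.MinSpace n p, (F f : EntireOp.CSpace n → ℂ) = P.apply f) := by
  refine ⟨EntireOp.FormalOp.cond_tfae hp, fun P hP => ?_, fun F => ?_⟩
  · have h := (EntireOp.FormalOp.mem_dClass_iff hp).1 hP
    exact ⟨fun f => ⟨h.summable_term hp f, h.term_mem hp f, h.apply_mem hp f, h.hasSum_term hp f⟩,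
      h.toCLM hp, fun _ => rfl⟩
  · exact ⟨EntireOp.symbol hp F,
      ⟨(EntireOp.FormalOp.mem_dClass_iff hp).2 (EntireOp.symbol_condII hp F),
        EntireOp.symbol_apply hp F⟩, fun P hP => EntireOp.eq_symbol hp F P hP.2⟩
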